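/- Let $\sigma\in\{1,-1\}$, let $2\le p\le n$ be integers, and let $b_p,\dots,b_n$ be real numbers with $b_p<0$. Consider, in cylindrical coordinates $(r,\varphi,z)$ on $\mathbb{R}^3$, the system $$\dot r=\sigma r^3,\qquad \dot\varphi=1,\qquad \dot z=b_pz^p+b_{p+1}z^{p+1}+\dots+b_nz^n$$ (this is the reduced normal form $\dot r=\sigma r\bigl(r^{2l}+\sum_{i=0}^{l-1}a_ir^{2i}\bigr)$, $\dot\varphi=1$, $\dot z=b_2z^2+\dots+b_nz^n$ with $l=1$, $a_0=0$ and first nonzero coefficient $b_p$ in the $z$-equation). By a spatial spiral trajectory near the origin we mean the set $\Gamma\subset\mathbb{R}^3$ traced by a solution with $r>0$ over a time half-line $[t_0,\infty)$ or $(-\infty,t_0]$ that tends to the origin as $t\to\infty$, respectively $t\to-\infty$, and that is not contained in the invariant plane $z=0$. Then every spatial spiral trajectory $\Gamma$ near the origin is bounded, its lower and upper box dimensions coincide, and (i) if $2\le p\le 3$, then $\dim_B\Gamma=\frac43$; (ii) if $p\ge4$, then $\dim_B\Gamma=\frac32-\frac1{2p}$. Moreover, there is $\delta>0$ such that a spatial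 spiral trajectory near the origin passes through every point $(r_0,\varphi_0,z_0)$ with $0<r_0<\delta$, $|z_0|<\delta$ and $\sigma b_pz_0^{p-1}>0$; in particular, for $\sigma=-1$, through every point with $0<r_0<\delta$, $0<z_0<\delta$. Here, for bounded $A\subset\mathbb{R}^N$ with open $\varepsilon$-neighbourhood $A_\varepsilon$ of Lebesgue measure $|A_\varepsilon|$, the lower and upper box dimensions are the infima of those $s\ge0$ for which $\liminf_{\varepsilon\to0^+}|A_\varepsilon|/\varepsilon^{N-s}=0$, respectively $\limsup_{\varepsilon\to0^+}|A_\varepsilon|/\varepsilon^{N-s}=0$; $\dim_BA$ is their common value. -/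

import Mathlib

open Filter Topology MeasureTheory

noncomputable section

/-- Lower `s`-dimensional Minkowski content of `A ⊆ ℝ^N`:
`liminf_{ε → 0+} |A_ε| / ε^(N - s)`, where `A_ε` is the open `ε`-neighbourhood. -/
def lowerMinkowskiContent {N : ℕ} (s : ℝ) (A : Set (EuclideanSpace ℝ (Fin N))) : ENNReal :=
  liminf (fun ε : ℝ => volume (Metric.thickening ε A) / ENNReal.ofReal (ε ^ ((N : ℝ) - s)))
    (𝓝[>] 0)

/-- Upper `s`-dimensional Minkowski content of `A ⊆ ℝ^N`. -/
def upperMinkowskiContent {N : ℕ} (s : ℝ) (A : Set (EuclideanSpace ℝ (Fin N))) : ENNReal :=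
  limsup (fun ε : ℝ => volume (Metric.thickening ε A) / ENNReal.ofReal (ε ^ ((N : ℝ) - s)))
    (𝓝[>] 0)

/-- Lower box dimension of a bounded set. -/
def lowerBoxDim {N : ℕ} (A : Set (EuclideanSpace ℝ (Fin N))) : ℝ :=
  sInf {s : ℝ | 0 ≤ s ∧ lowerMinkowskiContent s A = 0}

/-- Upper box dimension of a bounded set. -/
def upperBoxDim {N : ℕ} (A : Set (EuclideanSpace ℝ (Fin N))) : ℝ :=
  sInf {s : ℝ | 0 ≤ s ∧ upperMinkowskiContent s A = 0}

/-- `A` is bounded and its lower and upper box dimensions coincide and equal `d`. -/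
def HasBoxDim {N : ℕ} (A : Set (EuclideanSpace ℝ (Fin N))) (d : ℝ) : Prop :=
  Bornology.IsBounded A ∧ lowerBoxDim A = d ∧ upperBoxDim A = d

/-- The point of `ℝ³` with cylindrical coordinates `(r, φ, z)`. -/
def cylPoint (r φ z : ℝ) : EuclideanSpace ℝ (Fin 3) :=
  !₂[r * Real.cos φ, r * Real.sin φ, z]

/-- `(r, φ, z)` solves, on the time interval `J` and away from the axis `r = 0`, the system
`r' = σ r (r^(2l) + ∑_{i<l} a_i r^(2i))`, `φ' = 1`, `z' = b_2 z^2 + ⋯ + b_n z^n`. -/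
structure IsReducedSolution (σ : ℝ) (l : ℕ) (a : Fin l → ℝ) (n : ℕ) (b : ℕ → ℝ)
    (J : Set ℝ) (r φ z : ℝ → ℝ) : Prop where
  r_pos : ∀ t ∈ J, 0 < r t
  deriv_r : ∀ t ∈ J, HasDerivWithinAt r
    (σ * (r t * (r t ^ (2 * l) + ∑ i : Fin l, a i * r t ^ (2 * (i : ℕ))))) J t
  deriv_φ : ∀ t ∈ J, HasDerivWithinAt φ 1 J t
  deriv_z : ∀ t ∈ J, HasDerivWithinAt z (∑ i ∈ Finset.Icc 2 n, b i * z t ^ i) J t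

/-- `Γ ⊆ ℝ³` is a half-trajectory of the system (traced over `[t₀, ∞)` or over `(-∞, t₀]`) that
tends to the origin, lies off the axis `r = 0`, and is not contained in the invariant plane
`z = 0`. -/
def IsSpatialSpiral (σ : ℝ) (l : ℕ) (a : Fin l → ℝ) (n : ℕ) (b : ℕ → ℝ)
    (Γ : Set (EuclideanSpace ℝ (Fin 3))) : Prop :=
  ∃ (J : Set ℝ) (F : Filter ℝ) (r φ z : ℝ → ℝ),
    ((∃ t₀, J = Set.Ici t₀ ∧ F = atTop) ∨ (∃ t₀, J = Set.Iic t₀ ∧ F = atBot)) ∧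
    IsReducedSolution σ l a n b J r φ z ∧
    Tendsto (fun t => cylPoint (r t) (φ t) (z t)) F (𝓝 0) ∧
    (∃ t ∈ J, z t ≠ 0) ∧
    Γ = (fun t => cylPoint (r t) (φ t) (z t)) '' J

end

/-!
Near the origin both amplitudes solve `x' = x ^ (m + 1) * h x` with `h 0 ≠ 0`: `m = 2k` for the
radius, where `k` is the index of the first nonzero radial coefficient, and `m = p - 1` for the
height. Along a solution tending to `0`, `(x ^ (-m))' = -m * h x` has a nonzero limit, so `x` is of
exact order `s ^ (-1 / m)` and `x'` of exact order `s ^ (-1 / m - 1)`. Hence, up to an affine change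
of time, a spatial spiral winds at unit angular speed with radius of order `s ^ (-α)`,
`α = 1 / (2k)`, while its profile `(r, z)` moves like `s ^ (-β)`, where
`β = min (1 / (2k)) (1 / (p - 1))`.

At time `T` consecutive turns are at distance of order `δ = T ^ (-(1 + β))`. The part before `T` has
length of order `T ^ (1 - α)`, hence `δ`-covering number of order `T ^ (2 + β - α)`; the part after
`T` lies on a surface of revolution of size `T ^ (-β)` by `T ^ (-α)`, with a covering number of the
same order. Conversely, the turns made between the times `T` and `9T` already contain a
`δ`-separated set of that order, up to constants. So the box dimension is
`(2 + β - α) / (1 + β) = 1 + (1 - α) / (1 + β)`.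

A spiral through a given point is built by solving the two autonomous equations by separation of
variables; the sign condition makes radius and height decay in the same direction of time.
-/

open Set Asymptotics

section BoxDim

variable {N : ℕ} {A : Set (EuclideanSpace ℝ (Fin N))} {c C d s : ℝ}

theorem lowerMinkowskiContent_le_upperMinkowskiContent (s : ℝ)
    (A : Set (EuclideanSpace ℝ (Fin N))) :
    lowerMinkowskiContent s A ≤ upperMinkowskiContent s A :=
  liminf_le_limsup (by isBoundedDefault) (by isBoundedDefault)

theorem upperMinkowskiContent_eq_zero_of_lt (hs : d < s)
    (h : ∀ᶠ ε : ℝ in 𝓝[>] 0,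
      volume (Metric.thickening ε A) ≤ ENNReal.ofReal (C * ε ^ ((N : ℝ) - d))) :
    upperMinkowskiContent s A = 0 := by
  have hlim : Tendsto (fun ε : ℝ => ENNReal.ofReal (C * ε ^ (s - d))) (𝓝[>] 0) (𝓝 0) := by
    have hcont : ContinuousAt (fun ε : ℝ => C * ε ^ (s - d)) 0 :=
      (Real.continuousAt_rpow_const 0 _ (Or.inr (by linarith))).const_mul C
    have h0 := ENNReal.tendsto_ofReal (hcont.tendsto.mono_left (nhdsWithin_le_nhds (s := Ioi 0)))
    rwa [Real.zero_rpow (by linarith), mul_zero, ENNReal.ofReal_zero] at h0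
  refine Tendsto.limsup_eq (tendsto_of_tendsto_of_tendsto_of_le_of_le' tendsto_const_nhds hlim
    (Eventually.of_forall fun _ => zero_le) ?_)
  filter_upwards [h, self_mem_nhdsWithin] with ε hε (ε_pos : 0 < ε)
  calc volume (Metric.thickening ε A) / ENNReal.ofReal (ε ^ ((N : ℝ) - s))
      ≤ ENNReal.ofReal (C * ε ^ ((N : ℝ) - d)) / ENNReal.ofReal (ε ^ ((N : ℝ) - s)) := by gcongr
    _ = ENNReal.ofReal (C * ε ^ (s - d)) := by
      rw [← ENNReal.ofReal_div_of_pos (by positivity), mul_div_assoc, ← Real.rpow_sub ε_pos,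
        sub_sub_sub_cancel_left]

theorem lowerMinkowskiContent_ne_zero_of_lt (hc : 0 < c) (hs : s < d)
    (h : ∀ᶠ ε : ℝ in 𝓝[>] 0,
      ENNReal.ofReal (c * ε ^ ((N : ℝ) - d)) ≤ volume (Metric.thickening ε A)) :
    lowerMinkowskiContent s A ≠ 0 := by
  suffices ENNReal.ofReal c ≤ lowerMinkowskiContent s A from
    ((ENNReal.ofReal_pos.2 hc).trans_le this).ne'
  refine le_liminf_of_le (by isBoundedDefault) ?_
  filter_upwards [h, Ioo_mem_nhdsGT one_pos] with ε hε ⟨ε_pos, ε_lt⟩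
  have hpow : 1 ≤ ε ^ (s - d) :=
    Real.one_le_rpow_of_pos_of_le_one_of_nonpos ε_pos ε_lt.le (by linarith)
  calc ENNReal.ofReal c ≤ ENNReal.ofReal (c * ε ^ (s - d)) := by
        gcongr; exact le_mul_of_one_le_right hc.le hpow
    _ = ENNReal.ofReal (c * ε ^ ((N : ℝ) - d)) / ENNReal.ofReal (ε ^ ((N : ℝ) - s)) := by
      rw [← ENNReal.ofReal_div_of_pos (by positivity), mul_div_assoc, ← Real.rpow_sub ε_pos,
        sub_sub_sub_cancel_left]
    _ ≤ volume (Metric.thickening ε A) / ENNReal.ofReal (ε ^ ((N : ℝ) - s)) := by gcongr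

theorem hasBoxDim_of_volume_bounds (hA : Bornology.IsBounded A) (hd : 0 ≤ d) (hc : 0 < c)
    (hlow : ∀ᶠ ε : ℝ in 𝓝[>] 0,
      ENNReal.ofReal (c * ε ^ ((N : ℝ) - d)) ≤ volume (Metric.thickening ε A))
    (hup : ∀ᶠ ε : ℝ in 𝓝[>] 0,
      volume (Metric.thickening ε A) ≤ ENNReal.ofReal (C * ε ^ ((N : ℝ) - d))) :
    HasBoxDim A d := by
  have upper_zero : ∀ s, d < s → upperMinkowskiContent s A = 0 := fun s hs =>
    upperMinkowskiContent_eq_zero_of_lt hs hup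
  have le_of_lower_zero : ∀ s, lowerMinkowskiContent s A = 0 → d ≤ s := fun s h0 =>
    not_lt.1 fun hs => lowerMinkowskiContent_ne_zero_of_lt hc hs hlow h0
  have lower_zero : ∀ s, upperMinkowskiContent s A = 0 → lowerMinkowskiContent s A = 0 :=
    fun s h0 => nonpos_iff_eq_zero.1 (h0 ▸ lowerMinkowskiContent_le_upperMinkowskiContent s A)
  have sInf_eq : ∀ S : Set ℝ, Ioi d ⊆ S → S ⊆ Ici d → sInf S = d := fun S hS hS' =>
    (isGLB_Ioi.of_subset_of_superset isGLB_Ici hS hS').csInf_eq (nonempty_Ioi.mono hS)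
  exact ⟨hA,
    sInf_eq _ (fun s hs => ⟨hd.trans hs.le, lower_zero s (upper_zero s hs)⟩)
      fun s hs => le_of_lower_zero s hs.2,
    sInf_eq _ (fun s hs => ⟨hd.trans hs.le, upper_zero s hs⟩)
      fun s hs => le_of_lower_zero s (lower_zero s hs.2)⟩

end BoxDim

section Counting

variable {X Y ι : Type*} [PseudoMetricSpace X] [PseudoMetricSpace Y] {A B : Set X}
  {δ δ' m n : ℝ}

/-- `A` is covered by the closed `δ`-balls around at most `n` points of the ambient space. Both
`δ` and `n` are real, so that powers of a scale parameter can be inserted without rounding. -/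
def HasNet (A : Set X) (δ n : ℝ) : Prop :=
  ∃ F : Finset X, (F.card : ℝ) ≤ n ∧ ∀ x ∈ A, ∃ y ∈ F, dist x y ≤ δ

/-- `A` contains at least `n` points with pairwise distances at least `δ`. This is the lower
counterpart of `HasNet`, with the same convention on `δ` and `n`. -/
def HasPacking (A : Set X) (δ n : ℝ) : Prop :=
  ∃ F : Finset X, ↑F ⊆ A ∧ n ≤ F.card ∧ (F : Set X).Pairwise fun x y => δ ≤ dist x y

theorem HasNet.mono (h : HasNet A δ m) (hBA : B ⊆ A) (hδ : δ ≤ δ') (hn : m ≤ n) :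
    HasNet B δ' n := by
  obtain ⟨F, hFm, hF⟩ := h
  refine ⟨F, hFm.trans hn, fun x hx => ?_⟩
  obtain ⟨y, hy, hxy⟩ := hF x (hBA hx)
  exact ⟨y, hy, hxy.trans hδ⟩

theorem HasNet.isBounded (h : HasNet A δ n) : Bornology.IsBounded A := by
  obtain ⟨F, -, hF⟩ := h
  refine ((Bornology.isBounded_biUnion_finset F).2 fun y _ => Metric.isBounded_closedBall
    (x := y) (r := δ)).subset fun x hx => ?_
  obtain ⟨y, hy, hxy⟩ := hF x hx
  exact mem_iUnion₂.2 ⟨y, hy, hxy⟩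

theorem HasNet.union (hA : HasNet A δ m) (hB : HasNet B δ n) : HasNet (A ∪ B) δ (m + n) := by
  classical
  obtain ⟨F, hFm, hF⟩ := hA
  obtain ⟨G, hGn, hG⟩ := hB
  refine ⟨F ∪ G, ?_, ?_⟩
  · have : ((F ∪ G).card : ℝ) ≤ F.card + G.card := mod_cast Finset.card_union_le F G
    linarith
  · rintro x (hx | hx)
    · obtain ⟨y, hy, hxy⟩ := hF x hx
      exact ⟨y, Finset.mem_union_left G hy, hxy⟩
    · obtain ⟨y, hy, hxy⟩ := hG x hx
      exact ⟨y, Finset.mem_union_right F hy, hxy⟩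

theorem HasNet.prod {B : Set Y} (hA : HasNet A δ m) (hB : HasNet B δ n) :
    HasNet (A ×ˢ B) δ (m * n) := by
  obtain ⟨F, hFm, hF⟩ := hA
  obtain ⟨G, hGn, hG⟩ := hB
  refine ⟨F ×ˢ G, ?_, fun x hx => ?_⟩
  · rw [Finset.card_product, Nat.cast_mul]
    exact mul_le_mul hFm hGn (Nat.cast_nonneg _) ((Nat.cast_nonneg _).trans hFm)
  · obtain ⟨y, hy, hxy⟩ := hF x.1 hx.1
    obtain ⟨z, hz, hxz⟩ := hG x.2 hx.2
    exact ⟨(y, z), Finset.mk_mem_product hy hz, max_le hxy hxz⟩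

theorem hasNet_Icc {L : ℝ} (hδ : 0 < δ) (hL : 0 ≤ L) : HasNet (Icc 0 L) δ (L / δ + 1) := by
  classical
  refine ⟨(Finset.range (⌊L / δ⌋₊ + 1)).image fun j : ℕ => j * δ, ?_, fun x hx => ?_⟩
  · calc ((Finset.image (fun j : ℕ => j * δ) (Finset.range (⌊L / δ⌋₊ + 1))).card : ℝ)
        ≤ (⌊L / δ⌋₊ + 1 : ℕ) :=
          mod_cast Finset.card_image_le.trans (Finset.card_range _).le
      _ ≤ L / δ + 1 := by
        push_cast; gcongr; exact Nat.floor_le (by positivity)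
  · have hx0 : 0 ≤ x / δ := div_nonneg hx.1 hδ.le
    refine ⟨⌊x / δ⌋₊ * δ, Finset.mem_image_of_mem _ (Finset.mem_range_succ_iff.2 ?_), ?_⟩
    · have := hx.2
      gcongr
    · have hle := (le_div_iff₀ hδ).1 (Nat.floor_le hx0)
      have hlt := (div_lt_iff₀ hδ).1 (Nat.lt_floor_add_one (x / δ))
      rw [Real.dist_eq, abs_of_nonneg (by linarith)]
      linarith

theorem HasNet.image_of_dist_le {I : Set ι} {f : ι → X} {g : ι → Y} {K : ℝ} (hK : 0 ≤ K)
    (hfg : ∀ s ∈ I, ∀ t ∈ I, dist (f s) (f t) ≤ K * dist (g s) (g t))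
    (h : HasNet (g '' I) δ n) : HasNet (f '' I) (2 * K * δ) n := by
  classical
  obtain ⟨F, hFn, hF⟩ := h
  rcases I.eq_empty_or_nonempty with rfl | ⟨i, -⟩
  · exact ⟨∅, by simpa using (Nat.cast_nonneg _).trans hFn, by simp⟩
  have hcenter : ∀ y, ∃ x, ∀ t ∈ I, dist (g t) y ≤ δ → dist (f t) x ≤ 2 * K * δ := by
    intro y
    by_cases hy : ∃ s ∈ I, dist (g s) y ≤ δ
    · obtain ⟨s, hs, hsy⟩ := hy
      refine ⟨f s, fun t ht hty => (hfg t ht s hs).trans ?_⟩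
      calc K * dist (g t) (g s) ≤ K * (δ + δ) := by
            gcongr; exact (dist_triangle_right _ _ y).trans (add_le_add hty hsy)
        _ = 2 * K * δ := by ring
    · exact ⟨f i, fun t ht hty => absurd ⟨t, ht, hty⟩ hy⟩
  choose x hx using hcenter
  refine ⟨F.image x, (Nat.cast_le.2 Finset.card_image_le).trans hFn, ?_⟩
  rintro _ ⟨t, ht, rfl⟩
  obtain ⟨y, hy, hty⟩ := hF _ (mem_image_of_mem g ht)
  exact ⟨x y, Finset.mem_image_of_mem x hy, hx y t ht hty⟩

theorem HasPacking.mono (h : HasPacking A δ n) (hAB : A ⊆ B) : HasPacking B δ n := by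
  obtain ⟨F, hFA, hF⟩ := h
  exact ⟨F, hFA.trans hAB, hF⟩

theorem hasPacking_of_indexed {F : Finset ι} {x : ι → X} (hδ : 0 < δ) (hn : n ≤ F.card)
    (hA : ∀ i ∈ F, x i ∈ A) (hsep : ∀ i ∈ F, ∀ j ∈ F, i ≠ j → δ ≤ dist (x i) (x j)) :
    HasPacking A δ n := by
  classical
  have hinj : InjOn x F := fun i hi j hj hij => by
    by_contra hne
    have := hsep i hi j hj hne
    rw [hij, dist_self] at this
    exact this.not_gt hδ
  refine ⟨F.image x, ?_, ?_, ?_⟩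
  · rw [Finset.coe_image]
    exact image_subset_iff.2 hA
  · rwa [Finset.card_image_of_injOn hinj]
  · rw [Finset.coe_image, hinj.pairwise_image]
    exact hsep

end Counting

section Volume

variable {E : Type*} [NormedAddCommGroup E] [NormedSpace ℝ E] [FiniteDimensional ℝ E]
  [MeasurableSpace E] [BorelSpace E] (μ : Measure E) [μ.IsAddHaarMeasure] {A : Set E}
  {δ ε n : ℝ}

theorem HasNet.measure_thickening_le (h : HasNet A δ n) (hε : 0 < δ + ε) :
    μ (Metric.thickening ε A) ≤
      ENNReal.ofReal (n * (δ + ε) ^ Module.finrank ℝ E) * μ (Metric.ball 0 1) := by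
  obtain ⟨F, hFn, hF⟩ := h
  have hcover : Metric.thickening ε A ⊆ ⋃ y ∈ F, Metric.ball y (δ + ε) := by
    intro x hx
    obtain ⟨a, ha, hxa⟩ := Metric.mem_thickening_iff.1 hx
    obtain ⟨y, hy, hay⟩ := hF a ha
    refine mem_iUnion₂.2 ⟨y, hy, ?_⟩
    rw [Metric.mem_ball]
    linarith [dist_triangle x a y]
  calc μ (Metric.thickening ε A) ≤ ∑ y ∈ F, μ (Metric.ball y (δ + ε)) :=
        (measure_mono hcover).trans (measure_biUnion_finset_le _ _)
    _ = ENNReal.ofReal (F.card * (δ + ε) ^ Module.finrank ℝ E) * μ (Metric.ball 0 1) := by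
        simp only [Measure.addHaar_ball_of_pos μ _ hε, Finset.sum_const, nsmul_eq_mul]
        rw [ENNReal.ofReal_mul (Nat.cast_nonneg _), ENNReal.ofReal_natCast, mul_assoc]
    _ ≤ ENNReal.ofReal (n * (δ + ε) ^ Module.finrank ℝ E) * μ (Metric.ball 0 1) := by gcongr

theorem HasPacking.le_measure_thickening (h : HasPacking A (2 * ε) n) (hε : 0 < ε) :
    ENNReal.ofReal (n * ε ^ Module.finrank ℝ E) * μ (Metric.ball 0 1) ≤
      μ (Metric.thickening ε A) := by
  obtain ⟨F, hFA, hFn, hF⟩ := h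
  have hdisj : (F : Set E).PairwiseDisjoint fun x => Metric.ball x ε := fun x hx y hy hxy =>
    Metric.ball_disjoint_ball (by linarith [hF hx hy hxy])
  calc ENNReal.ofReal (n * ε ^ Module.finrank ℝ E) * μ (Metric.ball 0 1)
      ≤ ENNReal.ofReal (F.card * ε ^ Module.finrank ℝ E) * μ (Metric.ball 0 1) := by gcongr
    _ = ∑ x ∈ F, μ (Metric.ball x ε) := by
        simp only [Measure.addHaar_ball_of_pos μ _ hε, Finset.sum_const, nsmul_eq_mul]
        rw [ENNReal.ofReal_mul (Nat.cast_nonneg _), ENNReal.ofReal_natCast, mul_assoc]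
    _ = μ (⋃ x ∈ F, Metric.ball x ε) :=
        (measure_biUnion_finset hdisj fun _ _ => measurableSet_ball).symm
    _ ≤ μ (Metric.thickening ε A) := measure_mono (iUnion₂_subset fun x hx =>
        Metric.ball_subset_thickening (hFA hx) ε)

end Volume

section Scaling

variable {N : ℕ} {A : Set (EuclideanSpace ℝ (Fin N))} {a c C κ K m q : ℝ}

theorem eventually_nhdsGT_of_eventually_rpow_neg {P : ℝ → Prop} (hq : 0 < q) (hm : 0 < m)
    (h : ∀ᶠ T : ℝ in atTop, P (q * T ^ (-m))) : ∀ᶠ ε : ℝ in 𝓝[>] 0, P ε := by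
  have hlim : Tendsto (fun ε : ℝ => (q⁻¹ * ε) ^ (-m⁻¹)) (𝓝[>] 0) atTop := by
    refine (tendsto_rpow_neg_nhdsGT_zero (neg_lt_zero.2 (inv_pos.2 hm))).comp
      (tendsto_nhdsWithin_iff.2 ⟨?_, ?_⟩)
    · exact ((continuous_const_mul q⁻¹).tendsto' 0 0 (mul_zero _)).mono_left nhdsWithin_le_nhds
    · filter_upwards [self_mem_nhdsWithin] with ε (hε : 0 < ε)
      exact mul_pos (inv_pos.2 hq) hε
  filter_upwards [hlim.eventually h, self_mem_nhdsWithin] with ε hε (ε_pos : 0 < ε)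
  rwa [← Real.rpow_mul (by positivity), neg_mul_neg, inv_mul_cancel₀ hm.ne', Real.rpow_one,
    mul_inv_cancel_left₀ hq.ne'] at hε

theorem mul_rpow_neg_rpow_sub_div {T : ℝ} (hq : 0 < q) (hm : m ≠ 0) (hT : 0 < T) :
    (q * T ^ (-m)) ^ ((N : ℝ) - a / m) = q ^ (-(a / m)) * (T ^ a * (q * T ^ (-m)) ^ N) := by
  rw [sub_eq_neg_add, Real.rpow_add_natCast (by positivity),
    Real.mul_rpow hq.le (by positivity), ← Real.rpow_mul hT.le, neg_mul_neg,
    mul_div_cancel₀ _ hm, mul_assoc]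

theorem hasBoxDim_of_hasNet_of_hasPacking (hm : 0 < m) (ha : 0 ≤ a) (hK : 0 ≤ K) (hκ : 0 < κ)
    (hc : 0 < c)
    (hnet : ∀ᶠ T : ℝ in atTop, HasNet A (K * T ^ (-m)) (C * T ^ a))
    (hpack : ∀ᶠ T : ℝ in atTop, HasPacking A (κ * T ^ (-m)) (c * T ^ a)) :
    HasBoxDim A (a / m) := by
  obtain ⟨T₀, hT₀⟩ := hnet.exists
  obtain ⟨v, v_pos, hv⟩ : ∃ v : ℝ, 0 < v ∧
      volume (Metric.ball (0 : EuclideanSpace ℝ (Fin N)) 1) = ENNReal.ofReal v :=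
    ⟨_, ENNReal.toReal_pos (Metric.measure_ball_pos _ _ one_pos).ne' measure_ball_lt_top.ne,
      (ENNReal.ofReal_toReal measure_ball_lt_top.ne).symm⟩
  refine hasBoxDim_of_volume_bounds (c := c * v * (κ / 2) ^ (a / m))
    (C := C * v * (K + 1) ^ N) hT₀.isBounded (by positivity) (by positivity) ?_ ?_
  · refine eventually_nhdsGT_of_eventually_rpow_neg (half_pos hκ) hm ?_
    filter_upwards [hpack, eventually_gt_atTop 0] with T hT T_pos
    rw [show κ * T ^ (-m) = 2 * (κ / 2 * T ^ (-m)) by ring] at hT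
    refine le_of_eq_of_le ?_ (hT.le_measure_thickening volume (by positivity))
    rw [finrank_euclideanSpace_fin, mul_rpow_neg_rpow_sub_div (half_pos hκ) hm.ne' T_pos,
      hv, ← ENNReal.ofReal_mul' v_pos.le, Real.rpow_neg (half_pos hκ).le]
    congr 1
    field_simp
  · refine eventually_nhdsGT_of_eventually_rpow_neg one_pos hm ?_
    filter_upwards [hnet, eventually_gt_atTop 0] with T hT T_pos
    refine (hT.measure_thickening_le volume (by positivity)).trans_eq ?_
    rw [finrank_euclideanSpace_fin, mul_rpow_neg_rpow_sub_div one_pos hm.ne' T_pos,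
      hv, ← ENNReal.ofReal_mul' v_pos.le, Real.one_rpow, ← add_mul, mul_pow]
    congr 1
    ring

end Scaling

section CylindricalCoordinates

theorem dist_cylPoint_sq (r₁ φ₁ z₁ r₂ φ₂ z₂ : ℝ) :
    dist (cylPoint r₁ φ₁ z₁) (cylPoint r₂ φ₂ z₂) ^ 2 =
      r₁ ^ 2 + r₂ ^ 2 - 2 * r₁ * r₂ * Real.cos (φ₁ - φ₂) + (z₁ - z₂) ^ 2 := by
  rw [EuclideanSpace.dist_eq, Real.sq_sqrt (by positivity), Real.cos_sub]
  simp only [cylPoint, Fin.sum_univ_three, Real.dist_eq, sq_abs, PiLp.toLp_apply,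
    Matrix.cons_val]
  linear_combination r₁ ^ 2 * Real.sin_sq_add_cos_sq φ₁ + r₂ ^ 2 * Real.sin_sq_add_cos_sq φ₂

theorem dist_cylPoint_le (r₁ φ₁ z₁ r₂ φ₂ z₂ : ℝ) :
    dist (cylPoint r₁ φ₁ z₁) (cylPoint r₂ φ₂ z₂) ≤
      |r₁ - r₂| + |r₂| * |φ₁ - φ₂| + |z₁ - z₂| := by
  have radial : dist (cylPoint r₁ φ₁ z₁) (cylPoint r₂ φ₁ z₁) ≤ |r₁ - r₂| := by
    refine (le_abs_self _).trans (sq_le_sq.1 ?_)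
    rw [dist_cylPoint_sq, sub_self φ₁, Real.cos_zero]
    exact (by ring : _ = _).le
  have angular : dist (cylPoint r₂ φ₁ z₁) (cylPoint r₂ φ₂ z₁) ≤ |r₂| * |φ₁ - φ₂| := by
    rw [← abs_mul]
    refine (le_abs_self _).trans (sq_le_sq.1 ?_)
    rw [dist_cylPoint_sq]
    nlinarith [mul_le_mul_of_nonneg_left (Real.one_sub_sq_div_two_le_cos (x := φ₁ - φ₂))
      (sq_nonneg r₂)]
  have vertical : dist (cylPoint r₂ φ₂ z₁) (cylPoint r₂ φ₂ z₂) ≤ |z₁ - z₂| := by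
    refine (le_abs_self _).trans (sq_le_sq.1 ?_)
    rw [dist_cylPoint_sq, sub_self φ₂, Real.cos_zero]
    exact (by ring : _ = _).le
  linarith [dist_triangle4 (cylPoint r₁ φ₁ z₁) (cylPoint r₂ φ₁ z₁) (cylPoint r₂ φ₂ z₁)
    (cylPoint r₂ φ₂ z₂)]

theorem half_abs_sub_add_abs_sub_le_dist_cylPoint {r₁ r₂ : ℝ} (hr : 0 ≤ r₁ * r₂)
    (φ₁ z₁ φ₂ z₂ : ℝ) :
    (|r₁ - r₂| + |z₁ - z₂|) / 2 ≤ dist (cylPoint r₁ φ₁ z₁) (cylPoint r₂ φ₂ z₂) := by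
  refine le_of_sq_le_sq ?_ dist_nonneg
  rw [dist_cylPoint_sq]
  nlinarith [sq_nonneg (|r₁ - r₂| - |z₁ - z₂|), sq_abs (r₁ - r₂), sq_abs (z₁ - z₂),
    mul_le_mul_of_nonneg_left (Real.cos_le_one (φ₁ - φ₂)) hr]

theorem abs_mul_abs_sin_sub_le_dist_cylPoint (r₁ φ₁ z₁ r₂ φ₂ z₂ : ℝ) :
    |r₁| * |Real.sin (φ₁ - φ₂)| ≤ dist (cylPoint r₁ φ₁ z₁) (cylPoint r₂ φ₂ z₂) := by
  rw [← abs_mul]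
  refine abs_le_of_sq_le_sq ?_ dist_nonneg
  rw [dist_cylPoint_sq]
  have hproj : 0 ≤ (r₁ * Real.cos (φ₁ - φ₂) - r₂) ^ 2 + (z₁ - z₂) ^ 2 := by positivity
  nlinarith [Real.sin_sq_add_cos_sq (φ₁ - φ₂), hproj]

theorem cylPoint_zero_zero (φ : ℝ) : cylPoint 0 φ 0 = 0 := by
  ext i
  fin_cases i <;> simp [cylPoint]

theorem norm_cylPoint (r φ z : ℝ) : ‖cylPoint r φ z‖ = √(r ^ 2 + z ^ 2) := by
  rw [← dist_zero_right, ← cylPoint_zero_zero φ, eq_comm, Real.sqrt_eq_iff_eq_sq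
    (by positivity) dist_nonneg, dist_cylPoint_sq]
  ring

theorem abs_fst_le_norm_cylPoint (r φ z : ℝ) : |r| ≤ ‖cylPoint r φ z‖ := by
  rw [norm_cylPoint]
  exact Real.abs_le_sqrt (le_add_of_nonneg_right (sq_nonneg z))

theorem abs_thd_le_norm_cylPoint (r φ z : ℝ) : |z| ≤ ‖cylPoint r φ z‖ := by
  rw [norm_cylPoint]
  exact Real.abs_le_sqrt (le_add_of_nonneg_left (sq_nonneg r))

theorem tendsto_cylPoint_zero_iff {F : Filter ℝ} {r φ z : ℝ → ℝ} :
    Tendsto (fun t => cylPoint (r t) (φ t) (z t)) F (𝓝 0) ↔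
      Tendsto r F (𝓝 0) ∧ Tendsto z F (𝓝 0) := by
  constructor
  · intro h
    have hnorm := tendsto_zero_iff_norm_tendsto_zero.1 h
    exact ⟨squeeze_zero_norm (fun t => abs_fst_le_norm_cylPoint _ (φ t) (z t)) hnorm,
      squeeze_zero_norm (fun t => abs_thd_le_norm_cylPoint (r t) (φ t) _) hnorm⟩
  · rintro ⟨hr, hz⟩
    rw [tendsto_zero_iff_norm_tendsto_zero]
    have hlim : Tendsto (fun t => √(r t ^ 2 + z t ^ 2)) F (𝓝 √(0 ^ 2 + 0 ^ 2)) :=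
      ((hr.pow 2).add (hz.pow 2)).sqrt
    simpa [norm_cylPoint] using hlim

theorem exists_mem_Icc_cylPoint_eq (r φ z : ℝ) :
    ∃ ψ ∈ Icc 0 (2 * Real.pi), cylPoint r φ z = cylPoint r ψ z := by
  refine ⟨toIcoMod Real.two_pi_pos 0 φ, ?_, ?_⟩
  · simpa only [zero_add] using Ico_subset_Icc_self (toIcoMod_mem_Ico Real.two_pi_pos 0 φ)
  · rw [toIcoMod, zsmul_eq_mul]
    simp only [cylPoint, Real.cos_sub_int_mul_two_pi, Real.sin_sub_int_mul_two_pi]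

end CylindricalCoordinates

section PowerSpiral

/-- `(r, φ, z)` winds at unit angular speed around the `z`-axis, at distance of order `s ^ (-α)`,
and its meridian profile `(r, z)` moves from time `s` to time `t` by an amount comparable with
`s ^ (-β) - t ^ (-β)`; `profile_lower` states the lower bound in the weaker but handier form given
by the mean value theorem. -/
structure IsPowerSpiral (α β : ℝ) (r φ z : ℝ → ℝ) : Prop where
  abs_angle_sub : ∀ s ≥ 1, ∀ t ≥ 1, |φ s - φ t| = |s - t|
  radius_upper : ∃ C, ∀ s ≥ 1, |r s| ≤ C * s ^ (-α)
  radius_lower : ∃ c > 0, ∀ᶠ s in atTop, c * s ^ (-α) ≤ r s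
  profile_upper : ∃ C ≥ 0, ∀ s ≥ 1, ∀ t ≥ 1,
    |r s - r t| + |z s - z t| ≤ C * |s ^ (-β) - t ^ (-β)|
  profile_lower : ∃ c > 0, ∀ᶠ s in atTop, ∀ t ≥ s,
    c * (t - s) * t ^ (-1 - β) ≤ |r s - r t| + |z s - z t|

variable {α β δ ρ θ T C K : ℝ} {r φ z : ℝ → ℝ}

theorem abs_sub_le_mul_abs_rpow_sub_rpow {f f' : ℝ → ℝ} {q s t : ℝ} (hq : q ≠ 0) (hs : 0 < s)
    (hst : s ≤ t) (hf : ContinuousOn f (Icc s t)) (hf' : ∀ x ∈ Ioo s t, HasDerivAt f (f' x) x)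
    (hle : ∀ x ∈ Ioo s t, |f' x| ≤ C * x ^ (q - 1)) :
    |f s - f t| ≤ C / |q| * |s ^ q - t ^ q| := by
  rcases hst.eq_or_lt with rfl | hst
  · simp
  have hg : ∀ x, s ≤ x → HasDerivAt (fun y : ℝ => y ^ q) (q * x ^ (q - 1)) x := fun x hx =>
    Real.hasDerivAt_rpow_const (Or.inl (hs.trans_le hx).ne')
  obtain ⟨x, hx, hratio⟩ := exists_ratio_hasDerivAt_eq_ratio_slope f f' hst hf hf'
    (fun y => y ^ q) (fun y => q * y ^ (q - 1))
    (fun y hy => (hg y hy.1).continuousAt.continuousWithinAt) fun y hy => hg y hy.1.le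
  have hpow : 0 < x ^ (q - 1) := Real.rpow_pos_of_pos (hs.trans hx.1) _
  have habs : |t ^ q - s ^ q| * |f' x| = |f t - f s| * (|q| * x ^ (q - 1)) := by
    rw [← abs_of_pos hpow, ← abs_mul, ← abs_mul, ← abs_mul, hratio]
  rw [abs_sub_comm, abs_sub_comm (s ^ q), div_mul_eq_mul_div, le_div_iff₀ (abs_pos.2 hq)]
  refine le_of_mul_le_mul_right ?_ hpow
  calc |f t - f s| * |q| * x ^ (q - 1) = |t ^ q - s ^ q| * |f' x| := by rw [habs, mul_assoc]
    _ ≤ |t ^ q - s ^ q| * (C * x ^ (q - 1)) := by gcongr; exact hle x hx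
    _ = C * |t ^ q - s ^ q| * x ^ (q - 1) := by ring

theorem abs_sub_mul_rpow_neg_le {s t : ℝ} (hα : 0 ≤ α) (hα1 : α < 1) (hs : 0 < s) (hst : s ≤ t) :
    |s - t| * t ^ (-α) ≤ 1 / (1 - α) * |s ^ (1 - α) - t ^ (1 - α)| := by
  have ht : 0 < t := hs.trans_le hst
  have hmul : |s * t ^ (-α) - t * t ^ (-α)| ≤ 1 / |1 - α| * |s ^ (1 - α) - t ^ (1 - α)| := by
    refine abs_sub_le_mul_abs_rpow_sub_rpow (f := fun x => x * t ^ (-α)) (sub_pos.2 hα1).ne' hs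
      hst (by fun_prop) (fun x _ => (hasDerivAt_id x).mul_const _) fun x hx => ?_
    rw [one_mul, one_mul, abs_of_pos (by positivity), sub_sub_cancel_left]
    exact Real.rpow_le_rpow_of_nonpos (hs.trans hx.1) hx.2.le (by linarith)
  rwa [← sub_mul, abs_mul, abs_of_pos (Real.rpow_pos_of_pos ht _), abs_of_pos (sub_pos.2 hα1)]
    at hmul

theorem abs_rpow_neg_sub_rpow_neg_le {s t : ℝ} (hβ : 0 ≤ β) (hα1 : α < 1) (hs : 1 ≤ s)
    (hst : s ≤ t) :
    |s ^ (-β) - t ^ (-β)| ≤ β / (1 - α) * |s ^ (1 - α) - t ^ (1 - α)| := by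
  have hderiv : ∀ x, s ≤ x → HasDerivAt (fun y : ℝ => y ^ (-β)) (-β * x ^ (-β - 1)) x :=
    fun x hx => Real.hasDerivAt_rpow_const (Or.inl (by linarith))
  refine (abs_sub_le_mul_abs_rpow_sub_rpow (f := fun y : ℝ => y ^ (-β)) (C := β)
    (sub_pos.2 hα1).ne' (by linarith) hst
    (fun x hx => (hderiv x hx.1).continuousAt.continuousWithinAt) (fun x hx => hderiv x hx.1.le)
    fun x hx => ?_).trans_eq (by rw [abs_of_pos (sub_pos.2 hα1)])
  have hx1 : 1 ≤ x := hs.trans hx.1.le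
  rw [abs_mul, abs_neg, abs_of_nonneg hβ, abs_of_nonneg (by positivity)]
  gcongr
  linarith

theorem IsPowerSpiral.exists_hasNet_tail (h : IsPowerSpiral α β r φ z) (hα : 0 ≤ α) (hα1 : α < 1)
    (hβ : 0 ≤ β) :
    ∃ K ≥ 0, ∀ δ > 0, ∀ T ≥ 1,
      HasNet ((fun s => cylPoint (r s) (φ s) (z s)) '' Icc 1 T) (K * δ)
        (T ^ (1 - α) / δ + 1) := by
  obtain ⟨Cr, hr⟩ := h.radius_upper
  obtain ⟨Cp, hCp, hp⟩ := h.profile_upper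
  have hCr : 0 ≤ Cr := by simpa using (abs_nonneg _).trans (hr 1 le_rfl)
  have hα' : 0 < 1 - α := sub_pos.2 hα1
  set K := (Cp * β + Cr) / (1 - α) with hK
  have lipschitz : ∀ s t, 1 ≤ s → s ≤ t →
      dist (cylPoint (r s) (φ s) (z s)) (cylPoint (r t) (φ t) (z t)) ≤
        K * dist (s ^ (1 - α)) (t ^ (1 - α)) := by
    intro s t hs hst
    calc dist (cylPoint (r s) (φ s) (z s)) (cylPoint (r t) (φ t) (z t))
        ≤ (|r s - r t| + |z s - z t|) + |φ s - φ t| * |r t| := by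
          linarith [dist_cylPoint_le (r s) (φ s) (z s) (r t) (φ t) (z t)]
      _ ≤ Cp * |s ^ (-β) - t ^ (-β)| + |s - t| * (Cr * t ^ (-α)) := by
          rw [h.abs_angle_sub s hs t (hs.trans hst)]
          gcongr
          exacts [hp s hs t (hs.trans hst), hr t (hs.trans hst)]
      _ ≤ Cp * (β / (1 - α) * |s ^ (1 - α) - t ^ (1 - α)|) +
            Cr * (1 / (1 - α) * |s ^ (1 - α) - t ^ (1 - α)|) := by
          rw [mul_left_comm |s - t|]
          have hs0 : 0 < s := by linarith
          exact add_le_add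
            (mul_le_mul_of_nonneg_left (abs_rpow_neg_sub_rpow_neg_le hβ hα1 hs hst) hCp)
            (mul_le_mul_of_nonneg_left (abs_sub_mul_rpow_neg_le hα hα1 hs0 hst) hCr)
      _ = K * dist (s ^ (1 - α)) (t ^ (1 - α)) := by rw [hK, Real.dist_eq]; ring
  refine ⟨2 * K, by positivity, fun δ hδ T hT => ?_⟩
  refine HasNet.image_of_dist_le (g := fun s : ℝ => s ^ (1 - α)) (by positivity)
    (fun s hs t ht => ?_)
    ((hasNet_Icc hδ (by positivity)).mono (image_subset_iff.2 fun s hs => ?_) le_rfl le_rfl)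
  · rcases le_total s t with hst | hst
    · exact lipschitz s t hs.1 hst
    · rw [dist_comm, dist_comm (s ^ (1 - α))]
      exact lipschitz t s ht.1 hst
  · have hs0 : 0 ≤ s := zero_le_one.trans hs.1
    exact ⟨by positivity, Real.rpow_le_rpow hs0 hs.2 hα'.le⟩

-- Beyond time `T` the angle is forgotten: the set lies in the profile rotated about the axis.
theorem IsPowerSpiral.exists_hasNet_nucleus (h : IsPowerSpiral α β r φ z) (hα : 0 ≤ α)
    (hβ : 0 ≤ β) :
    ∃ K ≥ 0, ∀ δ > 0, ∀ T ≥ 1,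
      HasNet ((fun s => cylPoint (r s) (φ s) (z s)) '' Ici T) (K * δ)
        ((T ^ (-β) / δ + 1) * (T ^ (-α) * (2 * Real.pi) / δ + 1)) := by
  obtain ⟨Cr, hr⟩ := h.radius_upper
  obtain ⟨Cp, hCp, hp⟩ := h.profile_upper
  have hCr : 0 ≤ Cr := by simpa using (abs_nonneg _).trans (hr 1 le_rfl)
  choose ψ hψ hφψ using fun s => exists_mem_Icc_cylPoint_eq (r s) (φ s) (z s)
  simp only [hφψ]
  refine ⟨2 * (Cp + Cr), by positivity, fun δ hδ T hT => ?_⟩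
  have T_pos : 0 < T := by linarith
  refine HasNet.image_of_dist_le (g := fun s => (s ^ (-β), T ^ (-α) * ψ s)) (by positivity)
    (fun s hs t ht => ?_)
    (((hasNet_Icc hδ (by positivity)).prod (hasNet_Icc hδ (by positivity))).mono
      (image_subset_iff.2 fun s hs => ?_) le_rfl le_rfl)
  · have hrt : |r t| ≤ Cr * T ^ (-α) := (hr t (hT.trans ht)).trans <|
      mul_le_mul_of_nonneg_left (Real.rpow_le_rpow_of_nonpos T_pos ht (by linarith)) hCr
    rw [Prod.dist_eq, Real.dist_eq, Real.dist_eq, ← mul_sub, abs_mul,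
      abs_of_pos (Real.rpow_pos_of_pos T_pos _)]
    set M := max |s ^ (-β) - t ^ (-β)| (T ^ (-α) * |ψ s - ψ t|)
    calc dist (cylPoint (r s) (ψ s) (z s)) (cylPoint (r t) (ψ t) (z t))
        ≤ (|r s - r t| + |z s - z t|) + |r t| * |ψ s - ψ t| := by
          linarith [dist_cylPoint_le (r s) (ψ s) (z s) (r t) (ψ t) (z t)]
      _ ≤ Cp * |s ^ (-β) - t ^ (-β)| + Cr * T ^ (-α) * |ψ s - ψ t| := by
          gcongr
          exact hp s (hT.trans hs) t (hT.trans ht)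
      _ ≤ Cp * M + Cr * M := by
          rw [mul_assoc]
          gcongr
          exacts [le_max_left _ _, le_max_right _ _]
      _ = (Cp + Cr) * M := by ring
  · have hs0 : 0 < s := T_pos.trans_le hs
    have := (hψ s).1
    exact ⟨⟨by positivity, Real.rpow_le_rpow_of_nonpos T_pos hs (by linarith)⟩,
      by positivity, mul_le_mul_of_nonneg_left (hψ s).2 (by positivity)⟩

theorem IsPowerSpiral.exists_hasNet (h : IsPowerSpiral α β r φ z) (hα : 0 ≤ α) (hα1 : α < 1)
    (hβ : 0 ≤ β) :
    ∃ K C, 0 ≤ K ∧ ∀ T ≥ 1,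
      HasNet ((fun s => cylPoint (r s) (φ s) (z s)) '' Ici 1) (K * T ^ (-(1 + β)))
        (C * T ^ (2 + β - α)) := by
  obtain ⟨K₁, hK₁, tail⟩ := h.exists_hasNet_tail hα hα1 hβ
  obtain ⟨K₂, hK₂, nucleus⟩ := h.exists_hasNet_nucleus hα hβ
  refine ⟨K₁ + K₂, 2 + 2 * (2 * Real.pi + 1), by positivity, fun T hT => ?_⟩
  have T_pos : 0 < T := by linarith
  set ε := T ^ (-(1 + β)) with hε
  have ε_pos : 0 < ε := by positivity
  have div_ε : ∀ x, T ^ x / ε = T ^ (x + (1 + β)) := fun x => by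
    rw [hε, ← Real.rpow_sub T_pos, sub_neg_eq_add]
  have tail_count : T ^ (1 - α) / ε + 1 ≤ 2 * T ^ (2 + β - α) := by
    rw [div_ε, show 1 - α + (1 + β) = 2 + β - α by ring]
    linarith [Real.one_le_rpow hT (by linarith : 0 ≤ 2 + β - α)]
  have nucleus_count : (T ^ (-β) / ε + 1) * (T ^ (-α) * (2 * Real.pi) / ε + 1) ≤
      2 * (2 * Real.pi + 1) * T ^ (2 + β - α) := by
    have one_le : 1 ≤ T ^ (1 + β - α) := Real.one_le_rpow hT (by linarith)
    have split : T ^ (2 + β - α) = T * T ^ (1 + β - α) := by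
      rw [← Real.rpow_one_add' T_pos.le (by linarith)]
      congr 1
      ring
    rw [mul_div_right_comm, div_ε, div_ε, show -β + (1 + β) = 1 by ring, Real.rpow_one,
      show -α + (1 + β) = 1 + β - α by ring, split]
    calc (T + 1) * (T ^ (1 + β - α) * (2 * Real.pi) + 1)
        ≤ (T + T) * (T ^ (1 + β - α) * (2 * Real.pi) + T ^ (1 + β - α)) := by gcongr
      _ = 2 * (2 * Real.pi + 1) * (T * T ^ (1 + β - α)) := by ring
  rw [← Icc_union_Ici_eq_Ici hT, image_union]
  refine HasNet.mono (((tail ε ε_pos T hT).mono subset_rfl ?_ le_rfl).union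
    ((nucleus ε ε_pos T hT).mono subset_rfl ?_ le_rfl)) subset_rfl le_rfl
    ((add_le_add tail_count nucleus_count).trans_eq (by ring)) <;>
  gcongr <;> linarith

theorem abs_mul_half_abs_le_dist_cylPoint {r₁ φ₁ r₂ φ₂ x : ℝ} {k : ℤ} (hx : |x| ≤ 1)
    (hφ : |φ₁ - φ₂| = |x + k * (2 * Real.pi)|) (z₁ z₂ : ℝ) :
    |r₁| * (|x| / 2) ≤ dist (cylPoint r₁ φ₁ z₁) (cylPoint r₂ φ₂ z₂) := by
  refine le_trans ?_ (abs_mul_abs_sin_sub_le_dist_cylPoint r₁ φ₁ z₁ r₂ φ₂ z₂)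
  have hsin : |Real.sin (φ₁ - φ₂)| = |Real.sin x| := by
    rw [← Real.sin_add_int_mul_two_pi x k]
    rcases abs_eq_abs.1 hφ with h | h
    · rw [h]
    · rw [h, Real.sin_neg, abs_neg]
  have hpi : (1 / 2 : ℝ) ≤ 2 / Real.pi := by
    rw [div_le_div_iff₀ two_pos Real.pi_pos]
    linarith [Real.pi_le_four]
  rw [hsin]
  gcongr
  calc |x| / 2 = 1 / 2 * |x| := by ring
    _ ≤ 2 / Real.pi * |x| := by gcongr
    _ ≤ |Real.sin x| := Real.mul_abs_le_abs_sin (by linarith [Real.pi_gt_three])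

theorem le_dist_cylPoint_of_profile_or_angle {r₁ φ₁ z₁ r₂ φ₂ z₂ x : ℝ} {k : ℤ} (hρ : 0 ≤ ρ)
    (hρθ : 2 * δ ≤ ρ * θ) (hr₁ : ρ ≤ r₁) (hr₂ : ρ ≤ r₂) (hx : |x| ≤ 1)
    (hφ : |φ₁ - φ₂| = |x + k * (2 * Real.pi)|)
    (hsep : 2 * δ ≤ |r₁ - r₂| + |z₁ - z₂| ∨ θ ≤ |x|) :
    δ ≤ dist (cylPoint r₁ φ₁ z₁) (cylPoint r₂ φ₂ z₂) := by
  rcases hsep with profile | angle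
  · linarith [half_abs_sub_add_abs_sub_le_dist_cylPoint
      (mul_nonneg (hρ.trans hr₁) (hρ.trans hr₂)) φ₁ z₁ φ₂ z₂]
  · refine le_trans ?_ (abs_mul_half_abs_le_dist_cylPoint hx hφ _ _)
    calc δ ≤ ρ * (θ / 2) := by linarith
      _ ≤ |r₁| * (|x| / 2) := mul_le_mul_of_nonneg (hr₁.trans (le_abs_self _)) (by linarith) hρ
        (by positivity)

theorem half_le_natFloor {x : ℝ} (hx : 1 ≤ x) : x / 2 ≤ (⌊x⌋₊ : ℝ) := by
  have h1 := Nat.lt_floor_add_one x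
  have h2 : (1 : ℝ) ≤ ⌊x⌋₊ := mod_cast (Nat.one_le_floor_iff x).2 hx
  linarith

theorem natCast_mul_le_one_of_lt_natFloor {j : ℕ} (hθ : 0 < θ) (hj : j < ⌊1 / θ⌋₊) :
    j * θ ≤ 1 :=
  (le_div_iff₀ hθ).1 ((Nat.le_floor_iff (by positivity)).1 hj.le)

theorem add_two_pi_mul_add_mem_Icc {i : ℕ} {x : ℝ} (hi : i < ⌊T⌋₊) (hx0 : 0 ≤ x) (hx1 : x ≤ 1) :
    T + 2 * Real.pi * i + x ∈ Icc T (9 * T) := by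
  have hi1 : (i : ℝ) + 1 ≤ T := mod_cast (Nat.le_floor_iff' i.succ_ne_zero).1 hi
  constructor
  · rw [add_assoc]
    exact le_add_of_nonneg_right (by positivity)
  · nlinarith [Real.pi_lt_d2, Real.pi_pos]

-- The points sampled at the times `T + 2πi + jθ`: two of them with the same `j` have the same
-- polar angle and are separated by the profile, all others are separated by the angle.
theorem hasPacking_cylPoint_image (hT : 1 ≤ T) (hδ : 0 < δ) (hρ : 0 ≤ ρ) (hθ : 0 < θ) (hθ1 : θ ≤ 1)
    (hρθ : 2 * δ ≤ ρ * θ)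
    (hφ : ∀ s ∈ Icc T (9 * T), ∀ t ∈ Icc T (9 * T), |φ s - φ t| = |s - t|)
    (hr : ∀ s ∈ Icc T (9 * T), ρ ≤ r s)
    (hprofile : ∀ s ∈ Icc T (9 * T), ∀ t ∈ Icc T (9 * T), 6 ≤ |s - t| →
      2 * δ ≤ |r s - r t| + |z s - z t|) :
    HasPacking ((fun s => cylPoint (r s) (φ s) (z s)) '' Icc T (9 * T)) δ (T / (4 * θ)) := by
  set time : ℕ × ℕ → ℝ := fun x => T + 2 * Real.pi * x.1 + x.2 * θ with time_def
  have time_sub (x y : ℕ × ℕ) : time x - time y =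
      (x.2 * θ - y.2 * θ) + ((x.1 - y.1 : ℤ) : ℝ) * (2 * Real.pi) := by
    simp only [time_def]
    push_cast
    ring
  refine hasPacking_of_indexed (F := Finset.range ⌊T⌋₊ ×ˢ Finset.range ⌊1 / θ⌋₊)
    (x := fun x => cylPoint (r (time x)) (φ (time x)) (z (time x))) hδ ?_ ?_ ?_
  · rw [Finset.card_product, Finset.card_range, Finset.card_range, Nat.cast_mul]
    calc T / (4 * θ) = T / 2 * (1 / θ / 2) := by field_simp; norm_num
      _ ≤ ⌊T⌋₊ * ⌊1 / θ⌋₊ := by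
        gcongr
        exacts [half_le_natFloor hT, half_le_natFloor ((one_le_div hθ).2 hθ1)]
  all_goals simp only [Finset.mem_product, Finset.mem_range]
  · rintro x ⟨hx1, hx2⟩
    exact ⟨_, add_two_pi_mul_add_mem_Icc hx1 (by positivity)
      (natCast_mul_le_one_of_lt_natFloor hθ hx2), rfl⟩
  rintro x ⟨hx1, hx2⟩ y ⟨hy1, hy2⟩ hxy
  replace hx2 := natCast_mul_le_one_of_lt_natFloor hθ hx2
  replace hy2 := natCast_mul_le_one_of_lt_natFloor hθ hy2
  have hsx : time x ∈ Icc T (9 * T) := add_two_pi_mul_add_mem_Icc hx1 (by positivity) hx2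
  have hsy : time y ∈ Icc T (9 * T) := add_two_pi_mul_add_mem_Icc hy1 (by positivity) hy2
  have hangle : |x.2 * θ - y.2 * θ| ≤ 1 :=
    abs_sub_le_of_nonneg_of_le (by positivity) hx2 (by positivity) hy2
  refine le_dist_cylPoint_of_profile_or_angle hρ hρθ (hr _ hsx) (hr _ hsy) hangle
    ((hφ _ hsx _ hsy).trans (congrArg abs (time_sub x y))) ?_
  refine (eq_or_ne x.2 y.2).imp (fun hj => hprofile _ hsx _ hsy ?_) fun hj => ?_
  · have hi : (1 : ℝ) ≤ |(x.1 - y.1 : ℝ)| :=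
      Nat.pairwise_one_le_dist fun h => hxy (Prod.ext h hj)
    rw [time_sub, hj, sub_self, zero_add, abs_mul, abs_of_pos Real.two_pi_pos]
    push_cast
    nlinarith [Real.pi_gt_three]
  · rw [← sub_mul, abs_mul, abs_of_pos hθ]
    exact le_mul_of_one_le_left hθ.le (Nat.pairwise_one_le_dist hj)

theorem IsPowerSpiral.exists_eventually_window (h : IsPowerSpiral α β r φ z) (hα : 0 ≤ α)
    (hβ : 0 ≤ β) :
    ∃ ρ > 0, ∃ κ > 0, ∀ᶠ T : ℝ in atTop,
      (∀ s ∈ Icc T (9 * T), ρ * T ^ (-α) ≤ r s) ∧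
      ∀ s ∈ Icc T (9 * T), ∀ t ∈ Icc T (9 * T), 6 ≤ |s - t| →
        κ * T ^ (-(1 + β)) ≤ |r s - r t| + |z s - z t| := by
  obtain ⟨c, hc, hr⟩ := h.radius_lower
  obtain ⟨c', hc', hp⟩ := h.profile_lower
  obtain ⟨S, hS⟩ := eventually_atTop.1 (hr.and hp)
  refine ⟨c * 9 ^ (-α), by positivity, 6 * c' * 9 ^ (-1 - β), by positivity, ?_⟩
  filter_upwards [eventually_gt_atTop 0, eventually_ge_atTop S] with T T_pos hST
  have hprofile : ∀ s ∈ Icc T (9 * T), ∀ t ∈ Icc T (9 * T), s ≤ t → 6 ≤ |s - t| →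
      6 * c' * 9 ^ (-1 - β) * T ^ (-(1 + β)) ≤ |r s - r t| + |z s - z t| := by
    intro s hs t ht hst hsep
    rw [abs_sub_comm, abs_of_nonneg (sub_nonneg.2 hst)] at hsep
    calc 6 * c' * 9 ^ (-1 - β) * T ^ (-(1 + β)) = c' * 6 * (9 * T) ^ (-1 - β) := by
          rw [Real.mul_rpow (by norm_num) T_pos.le, neg_add']
          ring
      _ ≤ c' * (t - s) * t ^ (-1 - β) := by
          gcongr ?_ * ?_
          · gcongr
          · exact Real.rpow_le_rpow_of_nonpos (T_pos.trans_le ht.1) ht.2 (by linarith)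
      _ ≤ |r s - r t| + |z s - z t| := (hS s (hST.trans hs.1)).2 t hst
  refine ⟨fun s hs => ?_, fun s hs t ht hsep => ?_⟩
  · calc c * 9 ^ (-α) * T ^ (-α) = c * (9 * T) ^ (-α) := by
          rw [Real.mul_rpow (by norm_num) T_pos.le, mul_assoc]
      _ ≤ c * s ^ (-α) := mul_le_mul_of_nonneg_left
          (Real.rpow_le_rpow_of_nonpos (T_pos.trans_le hs.1) hs.2 (by linarith)) hc.le
      _ ≤ r s := (hS s (hST.trans hs.1)).1
  · rcases le_total s t with hst | hst
    · exact hprofile s hs t ht hst hsep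
    · rw [abs_sub_comm (r s), abs_sub_comm (z s)]
      exact hprofile t ht s hs hst (by rwa [abs_sub_comm])

theorem IsPowerSpiral.exists_hasPacking (h : IsPowerSpiral α β r φ z) (hα : 0 ≤ α) (hα1 : α < 1)
    (hβ : 0 ≤ β) :
    ∃ κ > 0, ∃ c > 0, ∀ᶠ T : ℝ in atTop,
      HasPacking ((fun s => cylPoint (r s) (φ s) (z s)) '' Ici 1) (κ * T ^ (-(1 + β)))
        (c * T ^ (2 + β - α)) := by
  obtain ⟨ρ, ρ_pos, κ, κ_pos, hwindow⟩ := h.exists_eventually_window hα hβ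
  have step_lim : Tendsto (fun T : ℝ => κ / ρ * T ^ (-(1 + β - α))) atTop (𝓝 0) := by
    simpa only [mul_zero] using (tendsto_rpow_neg_atTop (by linarith)).const_mul (κ / ρ)
  refine ⟨κ / 2, by positivity, ρ / (4 * κ), by positivity, ?_⟩
  filter_upwards [hwindow, eventually_ge_atTop 1,
    step_lim.eventually (eventually_le_nhds one_pos)] with T ⟨hradius, hprofile⟩ hT hstep
  have T_pos : 0 < T := by linarith
  have step_radius :
      2 * (κ / 2 * T ^ (-(1 + β))) = ρ * T ^ (-α) * (κ / ρ * T ^ (-(1 + β - α))) := by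
    rw [show -(1 + β) = -α + -(1 + β - α) by ring, Real.rpow_add T_pos]
    field_simp
  have count :
      ρ / (4 * κ) * T ^ (2 + β - α) = T / (4 * (κ / ρ * T ^ (-(1 + β - α)))) := by
    rw [Real.rpow_neg T_pos.le, show 2 + β - α = 1 + (1 + β - α) by ring,
      Real.rpow_add T_pos, Real.rpow_one]
    field_simp
  rw [count]
  refine (hasPacking_cylPoint_image hT (by positivity) (by positivity) (by positivity) hstep
    step_radius.le (fun s hs t ht => h.abs_angle_sub s (hT.trans hs.1) t (hT.trans ht.1))
    hradius fun s hs t ht hsep => ?_).mono (image_mono fun s hs => hT.trans hs.1)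
  exact le_of_eq_of_le (by ring) (hprofile s hs t ht hsep)

theorem IsPowerSpiral.hasBoxDim (h : IsPowerSpiral α β r φ z) (hα : 0 ≤ α) (hα1 : α < 1)
    (hβ : 0 ≤ β) :
    HasBoxDim ((fun s => cylPoint (r s) (φ s) (z s)) '' Ici 1) (1 + (1 - α) / (1 + β)) := by
  obtain ⟨K, C, hK, hnet⟩ := h.exists_hasNet hα hα1 hβ
  obtain ⟨κ, hκ, c, hc, hpack⟩ := h.exists_hasPacking hα hα1 hβ
  rw [show 1 + (1 - α) / (1 + β) = (2 + β - α) / (1 + β) by field_simp; ring]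
  exact hasBoxDim_of_hasNet_of_hasPacking (by linarith) (by linarith) hK hκ hc
    ((eventually_ge_atTop 1).mono hnet) hpack

end PowerSpiral

section DecayingSolution

/-- `x` is a forward solution of `x' = x ^ (m + 1) * h x` on `[1, ∞)`, other than the equilibrium
`0`, that tends to `0`. Both the radial and the vertical equation have this form near the origin,
after a time shift and possibly a time reversal. -/
structure IsDecayingSolution (m : ℕ) (h x : ℝ → ℝ) : Prop where
  hasDerivWithinAt : ∀ s ≥ 1, HasDerivWithinAt x (x s ^ (m + 1) * h (x s)) (Ici 1) s
  tendsto_zero : Tendsto x atTop (𝓝 0)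
  exists_ne_zero : ∃ s ≥ 1, x s ≠ 0

theorem isLittleO_id_of_tendsto_deriv_zero {E : Type*} [NormedAddCommGroup E] [NormedSpace ℝ E]
    {f f' : ℝ → E} (hf : ∀ᶠ s in atTop, HasDerivAt f (f' s) s) (hf' : Tendsto f' atTop (𝓝 0)) :
    f =o[atTop] (id : ℝ → ℝ) := by
  refine isLittleO_iff.2 fun ε hε => ?_
  have small : ∀ᶠ s in atTop, ‖f' s‖ ≤ ε / 2 := by
    filter_upwards [hf'.norm.eventually (gt_mem_nhds (norm_zero (E := E) ▸ half_pos hε))]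
      with s hs using hs.le
  obtain ⟨S, hS⟩ := eventually_atTop.1 ((hf.and small).and (eventually_ge_atTop 0))
  have S_nonneg : 0 ≤ S := (hS S le_rfl).2
  filter_upwards [eventually_ge_atTop S, eventually_ge_atTop (2 * ‖f S‖ / ε)] with s hs hs'
  have meanValue : ‖f s - f S‖ ≤ ε / 2 * ‖s - S‖ :=
    (convex_Ici S).norm_image_sub_le_of_norm_hasDerivWithin_le
      (fun t ht => (hS t ht).1.1.hasDerivWithinAt) (fun t ht => (hS t ht).1.2) self_mem_Ici hs
  rw [Real.norm_of_nonneg (sub_nonneg.2 hs)] at meanValue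
  rw [id, Real.norm_of_nonneg (S_nonneg.trans hs)]
  calc ‖f s‖ ≤ ‖f s - f S‖ + ‖f S‖ := norm_le_norm_sub_add _ _
    _ ≤ ε / 2 * (s - S) + ε / 2 * s :=
        add_le_add meanValue (by linarith [(div_le_iff₀ hε).1 hs'])
    _ ≤ ε * s := by linarith [mul_nonneg (half_pos hε).le S_nonneg]

theorem isTheta_id_of_tendsto_deriv {f f' : ℝ → ℝ} {B : ℝ} (hB : B ≠ 0)
    (hf : ∀ᶠ s in atTop, HasDerivAt f (f' s) s) (hf' : Tendsto f' atTop (𝓝 B)) :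
    f =Θ[atTop] id := by
  have hsub : (f - fun s => B * s) =o[atTop] id := by
    refine isLittleO_id_of_tendsto_deriv_zero (f' := fun s => f' s - B) ?_ (by
      simpa using hf'.sub_const B)
    filter_upwards [hf] with s hs
    exact hs.sub (by simpa using (hasDerivAt_id s).const_mul B)
  have hequiv : IsEquivalent atTop f fun s => B * id s := (isLittleO_const_mul_right_iff hB).2 hsub
  exact hequiv.isTheta.trans ((isTheta_refl id atTop).const_mul_left hB)

theorem isBigO_principal_Ici {E F : Type*} [NormedAddCommGroup E] [NormedAddCommGroup F]
    {f : ℝ → E} {g : ℝ → F} {a : ℝ} (hf : ContinuousOn f (Ici a)) (hg : ContinuousOn g (Ici a))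
    (hg₀ : ∀ s ∈ Ici a, g s ≠ 0) (h : f =O[atTop] g) : f =O[𝓟 (Ici a)] g := by
  obtain ⟨C, hC⟩ := h.bound
  obtain ⟨S, hS⟩ := eventually_atTop.1 hC
  have initial : f =O[𝓟 (Icc a S)] g :=
    ((hf.mono Icc_subset_Ici_self).isBigO_principal isCompact_Icc (c := (1 : ℝ)) (by simp)).trans
      ((hg.mono Icc_subset_Ici_self).isBigO_rev_principal isCompact_Icc
        (fun s hs => hg₀ s hs.1) 1)
  have final : f =O[𝓟 (Ici S)] g := isBigO_principal.2 ⟨C, hS⟩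
  refine (initial.sup final).mono ?_
  rw [sup_principal, principal_mono]
  exact fun s hs => (le_total s S).imp (⟨hs, ·⟩) id

theorem exists_forall_abs_le_mul_rpow {f : ℝ → ℝ} {q : ℝ} (hf : ContinuousOn f (Ici 1))
    (h : f =O[atTop] fun s => s ^ q) : ∃ C, ∀ s ≥ 1, |f s| ≤ C * s ^ q := by
  have pos : ∀ s ∈ Ici (1 : ℝ), 0 < s := fun s hs => zero_lt_one.trans_le hs
  obtain ⟨C, hC⟩ := isBigO_principal.1 (isBigO_principal_Ici hf
    (fun s hs => (Real.continuousAt_rpow_const s q (Or.inl (pos s hs).ne')).continuousWithinAt)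
    (fun s hs => (Real.rpow_pos_of_pos (pos s hs) q).ne') h)
  refine ⟨C, fun s hs => (hC s hs).trans_eq ?_⟩
  rw [Real.norm_of_nonneg (by positivity)]

theorem eq_zero_of_hasDerivWithinAt_mul {x q : ℝ → ℝ} {a b : ℝ} (hab : a ≤ b)
    (hx : ContinuousOn x (Icc a b)) (hq : ContinuousOn q (Icc a b))
    (hd : ∀ s ∈ Ioc a b, HasDerivWithinAt x (q s * x s) (Iic s) s) (hb : x b = 0) : x a = 0 := by
  obtain ⟨K, hK⟩ := isCompact_Icc.exists_bound_of_continuousOn hq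
  have hlip : ∀ s ∈ Ioc a b, LipschitzOnWith K.toNNReal (fun y => q s * y) univ := fun s hs =>
    (LipschitzWith.of_dist_le_mul fun y y' => by
      rw [dist_eq_norm, ← mul_sub, norm_mul, dist_eq_norm]
      gcongr
      exact (hK s (Ioc_subset_Icc_self hs)).trans (Real.le_coe_toNNReal K)).lipschitzOnWith
  exact ODE_solution_unique_of_mem_Icc_left (g := fun _ => 0) hlip hx hd (fun _ _ => mem_univ _)
    continuousOn_const (fun s _ => by simpa using hasDerivWithinAt_const s (Iic s) (0 : ℝ))
    (fun _ _ => mem_univ _) hb (left_mem_Icc.2 hab)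

namespace IsDecayingSolution

variable {m : ℕ} {h x : ℝ → ℝ}

theorem hasDerivAt (hx : IsDecayingSolution m h x) {s : ℝ} (hs : 1 < s) :
    HasDerivAt x (x s ^ (m + 1) * h (x s)) s :=
  (hx.hasDerivWithinAt s hs.le).hasDerivAt (Ici_mem_nhds hs)

theorem continuousOn (hx : IsDecayingSolution m h x) : ContinuousOn x (Ici 1) :=
  fun s hs => (hx.hasDerivWithinAt s hs).continuousWithinAt

theorem eventually_ne_zero (hx : IsDecayingSolution m h x) (hh : Continuous h) :
    ∀ᶠ s in atTop, x s ≠ 0 := by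
  obtain ⟨a, ha, hxa⟩ := hx.exists_ne_zero
  filter_upwards [eventually_ge_atTop a] with b hab hxb
  have hcont : ContinuousOn x (Icc a b) := hx.continuousOn.mono fun s hs => ha.trans hs.1
  refine hxa (eq_zero_of_hasDerivWithinAt_mul (q := fun s => x s ^ m * h (x s)) hab hcont
    (by fun_prop) (fun s hs => ?_) hxb)
  exact ((hx.hasDerivAt (lt_of_le_of_lt ha hs.1)).congr_deriv (by ring)).hasDerivWithinAt

variable (hx : IsDecayingSolution m h x) (hm : m ≠ 0) (hh : Continuous h) (hh₀ : h 0 ≠ 0)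
include hx hm hh hh₀

-- The substitution `u = x ^ (-m)` turns the equation into `u' = -m * h x`, and `h x → h 0`.
theorem isTheta_pow : (fun s => x s ^ m) =Θ[atTop] fun s => s⁻¹ := by
  have hlim : Tendsto (fun s => -m * h (x s)) atTop (𝓝 (-m * h 0)) :=
    ((hh.tendsto 0).comp hx.tendsto_zero).const_mul _
  have hderiv : ∀ᶠ s in atTop, HasDerivAt (fun s => (x s ^ m)⁻¹) (-m * h (x s)) s := by
    filter_upwards [eventually_gt_atTop 1, hx.eventually_ne_zero hh] with s hs hxs
    refine (((hx.hasDerivAt hs).pow m).inv (pow_ne_zero m hxs)).congr_deriv ?_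
    obtain ⟨k, rfl⟩ := Nat.exists_eq_succ_of_ne_zero hm
    simp only [Pi.pow_apply, Nat.succ_eq_add_one, Nat.add_sub_cancel]
    field_simp
    ring
  have hm₀ : -(m : ℝ) * h 0 ≠ 0 := mul_ne_zero (neg_ne_zero.2 (Nat.cast_ne_zero.2 hm)) hh₀
  simpa using (isTheta_id_of_tendsto_deriv hm₀ hderiv hlim).inv

theorem isTheta_rpow : x =Θ[atTop] fun s => s ^ (-(m : ℝ)⁻¹) := by
  have hroot := IsTheta.rpow (r := (m : ℝ)⁻¹)
    (Eventually.of_forall fun s => norm_nonneg (x s ^ m))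
    ((eventually_ge_atTop (0 : ℝ)).mono fun s hs => inv_nonneg.2 hs)
    (isTheta_norm_left.2 (hx.isTheta_pow hm hh hh₀))
  simp only [norm_pow, Real.pow_rpow_inv_natCast (norm_nonneg _) hm] at hroot
  refine (isTheta_norm_left.1 hroot).trans_eventuallyEq ?_
  filter_upwards [eventually_ge_atTop 0] with s hs
  rw [Real.inv_rpow hs, Real.rpow_neg hs]

theorem isTheta_deriv :
    (fun s => x s ^ (m + 1) * h (x s)) =Θ[atTop] fun s => s ^ (-(m : ℝ)⁻¹ - 1) := by
  have hconst : (fun s => h (x s)) =Θ[atTop] fun _ => (1 : ℝ) :=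
    (isEquivalent_const_iff_tendsto hh₀ |>.2
      ((hh.tendsto 0).comp hx.tendsto_zero)).isTheta.trans (isTheta_const_const hh₀ one_ne_zero)
  have hprod := ((hx.isTheta_pow hm hh hh₀).mul (hx.isTheta_rpow hm hh hh₀)).mul hconst
  simp only [← pow_succ] at hprod
  refine hprod.trans_eventuallyEq ?_
  filter_upwards [eventually_gt_atTop 0] with s hs
  rw [mul_one, Real.rpow_sub_one hs.ne', div_eq_inv_mul]

theorem exists_abs_le : ∃ C, ∀ s ≥ 1, |x s| ≤ C * s ^ (-(m : ℝ)⁻¹) :=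
  exists_forall_abs_le_mul_rpow hx.continuousOn (hx.isTheta_rpow hm hh hh₀).isBigO

theorem exists_abs_sub_le {β : ℝ} (hβ : 0 < β) (hβm : β ≤ (m : ℝ)⁻¹) :
    ∃ C ≥ 0, ∀ s ≥ 1, ∀ t ≥ 1, |x s - x t| ≤ C * |s ^ (-β) - t ^ (-β)| := by
  obtain ⟨C, hC⟩ := exists_forall_abs_le_mul_rpow
    ((hx.continuousOn.pow (m + 1)).mul (hh.comp_continuousOn hx.continuousOn))
    (hx.isTheta_deriv hm hh hh₀).isBigO
  have hC₀ : 0 ≤ C := by simpa using (abs_nonneg _).trans (hC 1 le_rfl)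
  refine ⟨C / |-β|, by positivity, fun s hs t ht => ?_⟩
  wlog hst : s ≤ t generalizing s t
  · rw [abs_sub_comm, abs_sub_comm (s ^ (-β))]
    exact this t ht s hs (le_of_not_ge hst)
  refine abs_sub_le_mul_abs_rpow_sub_rpow (neg_ne_zero.2 hβ.ne') (zero_lt_one.trans_le hs) hst
    (hx.continuousOn.mono fun u hu => hs.trans hu.1)
    (fun u hu => hx.hasDerivAt (lt_of_le_of_lt hs hu.1)) fun u hu => ?_
  have hu₁ : 1 ≤ u := hs.trans hu.1.le
  exact (hC u hu₁).trans (by gcongr)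

theorem exists_le_abs_sub :
    ∃ c > 0, ∀ᶠ s in atTop, ∀ t ≥ s, c * (t - s) * t ^ (-1 - (m : ℝ)⁻¹) ≤ |x s - x t| := by
  obtain ⟨C, hC, hbound⟩ := (hx.isTheta_deriv hm hh hh₀).symm.isBigO.exists_pos
  obtain ⟨S, hS⟩ := eventually_atTop.1 (isBigOWith_iff.1 hbound)
  refine ⟨C⁻¹, inv_pos.2 hC, ?_⟩
  filter_upwards [eventually_ge_atTop S, eventually_gt_atTop 1] with s hSs hs t hst
  rcases hst.eq_or_lt with rfl | hst
  · simp
  obtain ⟨u, ⟨hsu, hut⟩, hslope⟩ := exists_hasDerivAt_eq_slope x _ hst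
    (hx.continuousOn.mono fun v hv => hs.le.trans hv.1)
    fun v hv => hx.hasDerivAt (hs.trans hv.1)
  have hu₀ : 0 < u := by linarith
  have hderiv := hS u (hSs.trans hsu.le)
  rw [hslope, norm_div, Real.norm_of_nonneg (by positivity), Real.norm_eq_abs,
    Real.norm_of_nonneg (sub_nonneg.2 hst.le), abs_sub_comm, ← mul_div_assoc,
    le_div_iff₀ (sub_pos.2 hst)] at hderiv
  rw [mul_assoc, inv_mul_le_iff₀ hC, mul_comm, ← neg_add', add_comm, neg_add']
  calc t ^ (-(m : ℝ)⁻¹ - 1) * (t - s) ≤ u ^ (-(m : ℝ)⁻¹ - 1) * (t - s) := by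
        have hexp : -(m : ℝ)⁻¹ - 1 ≤ 0 := by linarith [inv_nonneg.2 (Nat.cast_nonneg (α := ℝ) m)]
        exact mul_le_mul_of_nonneg_right (Real.rpow_le_rpow_of_nonpos hu₀ hut.le hexp)
          (sub_nonneg.2 hst.le)
    _ ≤ C * |x s - x t| := hderiv

end IsDecayingSolution

theorem isPowerSpiral_of_isDecayingSolution {j m : ℕ} {f h r φ z : ℝ → ℝ} (hj : j ≠ 0)
    (hm : m ≠ 0) (hf : Continuous f) (hf₀ : f 0 ≠ 0) (hh : Continuous h) (hh₀ : h 0 ≠ 0)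
    (hr : IsDecayingSolution j f r) (r_nonneg : ∀ s ≥ 1, 0 ≤ r s) (hz : IsDecayingSolution m h z)
    (hφ : ∀ s ≥ 1, ∀ t ≥ 1, |φ s - φ t| = |s - t|) :
    IsPowerSpiral (j : ℝ)⁻¹ (min (j : ℝ)⁻¹ (m : ℝ)⁻¹) r φ z := by
  have hβ : 0 < min (j : ℝ)⁻¹ (m : ℝ)⁻¹ := by positivity
  refine ⟨hφ, hr.exists_abs_le hj hf hf₀, ?_, ?_, ?_⟩
  · obtain ⟨C, hC, hbound⟩ := (hr.isTheta_rpow hj hf hf₀).symm.isBigO.exists_pos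
    refine ⟨C⁻¹, inv_pos.2 hC, ?_⟩
    filter_upwards [isBigOWith_iff.1 hbound, eventually_ge_atTop 1] with s hs hs₁
    rwa [Real.norm_of_nonneg (by positivity), Real.norm_of_nonneg (r_nonneg s hs₁),
      ← inv_mul_le_iff₀ hC] at hs
  · obtain ⟨Cr, hCr, hr'⟩ := hr.exists_abs_sub_le hj hf hf₀ hβ (min_le_left _ _)
    obtain ⟨Cz, hCz, hz'⟩ := hz.exists_abs_sub_le hm hh hh₀ hβ (min_le_right _ _)
    refine ⟨Cr + Cz, add_nonneg hCr hCz, fun s hs t ht => ?_⟩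
    rw [add_mul]
    exact add_le_add (hr' s hs t ht) (hz' s hs t ht)
  · rcases min_choice (j : ℝ)⁻¹ (m : ℝ)⁻¹ with hmin | hmin <;> rw [hmin]
    · obtain ⟨c, hc, hlow⟩ := hr.exists_le_abs_sub hj hf hf₀
      exact ⟨c, hc, hlow.mono fun s hs t hst =>
        (hs t hst).trans (le_add_of_nonneg_right (abs_nonneg _))⟩
    · obtain ⟨c, hc, hlow⟩ := hz.exists_le_abs_sub hm hh hh₀
      exact ⟨c, hc, hlow.mono fun s hs t hst =>
        (hs t hst).trans (le_add_of_nonneg_left (abs_nonneg _))⟩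

end DecayingSolution

section Existence

variable {g : ℝ → ℝ} {D C w₀ : ℝ}

theorem intervalIntegrable_inv_of_continuousOn (hg : ContinuousOn g (Ioo 0 D))
    (hpos : ∀ w ∈ Ioo 0 D, 0 < g w) {x y : ℝ} (hx : x ∈ Ioo 0 D) (hy : y ∈ Ioo 0 D) :
    IntervalIntegrable (fun w => (g w)⁻¹) volume x y :=
  ((hg.inv₀ fun w hw => (hpos w hw).ne').mono
    (ordConnected_Ioo.uIcc_subset hx hy)).intervalIntegrable

theorem hasStrictDerivAt_integral_inv (hg : ContinuousOn g (Ioo 0 D))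
    (hpos : ∀ w ∈ Ioo 0 D, 0 < g w) (hw₀ : w₀ ∈ Ioo 0 D) {x : ℝ} (hx : x ∈ Ioo 0 D) :
    HasStrictDerivAt (fun y => ∫ w in y..w₀, (g w)⁻¹) (-(g x)⁻¹) x := by
  have hinv : ContinuousOn (fun w => (g w)⁻¹) (Ioo 0 D) := hg.inv₀ fun w hw => (hpos w hw).ne'
  exact intervalIntegral.integral_hasStrictDerivAt_left
    (intervalIntegrable_inv_of_continuousOn hg hpos hx hw₀)
    (hinv.stronglyMeasurableAtFilter isOpen_Ioo x hx)
    (hinv.continuousAt (isOpen_Ioo.mem_nhds hx))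

theorem tendsto_integral_inv_atTop (hg : ContinuousOn g (Ioo 0 D))
    (hpos : ∀ w ∈ Ioo 0 D, 0 < g w) (hle : ∀ w ∈ Ioo 0 D, g w ≤ C * w) (hw₀ : w₀ ∈ Ioo 0 D) :
    Tendsto (fun x => ∫ w in x..w₀, (g w)⁻¹) (𝓝[>] 0) atTop := by
  have hC : 0 < C := pos_of_mul_pos_left ((hpos w₀ hw₀).trans_le (hle w₀ hw₀)) hw₀.1.le
  have hlog : Tendsto (fun x => C⁻¹ * Real.log (w₀ / x)) (𝓝[>] 0) atTop :=
    (Real.tendsto_log_atTop.comp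
      (tendsto_inv_nhdsGT_zero.const_mul_atTop hw₀.1)).const_mul_atTop (inv_pos.2 hC)
  refine tendsto_atTop_mono' _ ?_ hlog
  filter_upwards [Ioo_mem_nhdsGT hw₀.1] with x hx
  have hxD : x ∈ Ioo 0 D := ⟨hx.1, hx.2.trans hw₀.2⟩
  calc C⁻¹ * Real.log (w₀ / x) = ∫ w in x..w₀, C⁻¹ * w⁻¹ := by
        rw [intervalIntegral.integral_const_mul, integral_inv_of_pos hx.1 hw₀.1]
    _ ≤ ∫ w in x..w₀, (g w)⁻¹ := by
        refine intervalIntegral.integral_mono_on hx.2.le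
          (intervalIntegrable_inv_of_continuousOn (by fun_prop)
            (fun w hw => hw.1) hxD hw₀ |>.const_mul _)
          (intervalIntegrable_inv_of_continuousOn hg hpos hxD hw₀) fun w hw => ?_
        have hwD : w ∈ Ioo 0 D := ⟨hx.1.trans_le hw.1, hw.2.trans_lt hw₀.2⟩
        rw [← mul_inv]
        exact inv_anti₀ (hpos w hwD) (hle w hwD)

-- Separation of variables: the solution inverts the time `∫ 1 / g` needed to descend from `w₀`,
-- which is infinite for the full descent to `0` because `g` is at most linear.
theorem exists_hasDerivAt_neg_tendsto_zero (hg : ContinuousOn g (Ioo 0 D))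
    (hpos : ∀ w ∈ Ioo 0 D, 0 < g w) (hle : ∀ w ∈ Ioo 0 D, g w ≤ C * w) (hw₀ : w₀ ∈ Ioo 0 D) :
    ∃ w : ℝ → ℝ, w 0 = w₀ ∧ (∀ t ≥ 0, w t ∈ Ioo 0 D ∧ HasDerivAt w (-g (w t)) t) ∧
      Tendsto w atTop (𝓝 0) := by
  set G : ℝ → ℝ := fun x => ∫ w in x..w₀, (g w)⁻¹
  have hG : ∀ x ∈ Ioo 0 D, HasStrictDerivAt G (-(g x)⁻¹) x := fun x hx =>
    hasStrictDerivAt_integral_inv hg hpos hw₀ hx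
  have hGw₀ : G w₀ = 0 := intervalIntegral.integral_same
  have hcont : ContinuousOn G (Ioo 0 D) := fun x hx =>
    (hG x hx).hasDerivAt.continuousAt.continuousWithinAt
  have hanti : StrictAntiOn G (Ioo 0 D) := by
    refine strictAntiOn_of_deriv_neg (convex_Ioo 0 D) hcont fun x hx => ?_
    rw [interior_Ioo] at hx
    rw [(hG x hx).hasDerivAt.deriv]
    exact neg_neg_of_pos (inv_pos.2 (hpos x hx))
  have hsurj : Ici 0 ⊆ G '' Ioo 0 D := by
    have hrange := isPreconnected_Ioo.intermediate_value_Ici hw₀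
      (le_principal_iff.2 (Ioo_mem_nhdsGT (hw₀.1.trans hw₀.2))) hcont
      (tendsto_integral_inv_atTop hg hpos hle hw₀)
    rwa [hGw₀] at hrange
  set W := Function.invFunOn G (Ioo 0 D)
  have hWG : ∀ x ∈ Ioo 0 D, W (G x) = x := fun x hx => hanti.injOn.leftInvOn_invFunOn hx
  refine ⟨W, hGw₀ ▸ hWG w₀ hw₀, fun t ht => ?_, ?_⟩
  · obtain ⟨x, hx, rfl⟩ := hsurj ht
    rw [hWG x hx]
    have hinv := (hG x hx).to_local_left_inverse (g := W)
      (neg_ne_zero.2 (inv_ne_zero (hpos x hx).ne'))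
      (eventually_of_mem (isOpen_Ioo.mem_nhds hx) hWG)
    rw [inv_neg, inv_inv] at hinv
    exact ⟨hx, hinv.hasDerivAt⟩
  · have hsmall : ∀ ε ∈ Ioo 0 D, ∀ᶠ t in atTop, W t ∈ Ioo 0 ε := fun ε hε => by
      filter_upwards [eventually_ge_atTop 0, eventually_gt_atTop (G ε)] with t ht htε
      obtain ⟨x, hx, rfl⟩ := hsurj ht
      rw [hWG x hx]
      exact ⟨hx.1, (hanti.lt_iff_gt hε hx).1 htε⟩
    refine tendsto_order.2 ⟨fun a ha => (hsmall w₀ hw₀).mono fun t ht => ha.trans ht.1,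
      fun a ha => ?_⟩
    filter_upwards [hsmall (min a w₀) ⟨lt_min ha hw₀.1, min_lt_of_right_lt hw₀.2⟩] with t ht
    exact ht.2.trans_le (min_le_left _ _)

theorem eventually_exists_isDecayingSolution_of_neg {h : ℝ → ℝ} (hh : Continuous h)
    (hh₀ : h 0 < 0) (m : ℕ) :
    ∀ᶠ x₀ in 𝓝[>] 0, ∃ x, x 1 = x₀ ∧ IsDecayingSolution m h x ∧ ∀ s ≥ 1, 0 < x s := by
  obtain ⟨δ, hδ, hnear⟩ : ∃ δ > 0, ∀ y, dist y 0 < δ → h y ∈ Ioo (2 * h 0) 0 :=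
    Metric.eventually_nhds_iff.1 (hh.continuousAt.eventually (Ioo_mem_nhds (by linarith) hh₀))
  set D := min δ 1
  have hD : ∀ w ∈ Ioo 0 D, h w ∈ Ioo (2 * h 0) 0 ∧ w ≤ 1 := fun w hw =>
    ⟨hnear w (by
      rw [Real.dist_0_eq_abs, abs_of_pos hw.1]
      exact hw.2.trans_le (min_le_left _ _)), hw.2.le.trans (min_le_right _ _)⟩
  filter_upwards [Ioo_mem_nhdsGT (lt_min hδ one_pos)] with x₀ hx₀
  obtain ⟨w, hw₀, hw, hw_lim⟩ := exists_hasDerivAt_neg_tendsto_zero (C := -2 * h 0)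
    (g := fun w => -h w * w ^ (m + 1)) (by fun_prop)
    (fun w hw => mul_pos (neg_pos.2 (hD w hw).1.2) (pow_pos hw.1 _))
    (fun w hw => mul_le_mul (by linarith [(hD w hw).1.1])
      (pow_le_of_le_one hw.1.le (hD w hw).2 m.succ_ne_zero) (pow_nonneg hw.1.le _)
      (by linarith)) hx₀
  have hpos : ∀ s ≥ 1, 0 < w (s - 1) := fun s hs => (hw _ (sub_nonneg.2 hs)).1.1
  refine ⟨fun s => w (s - 1), by simpa using hw₀, ⟨fun s hs => ?_,
    hw_lim.comp (tendsto_atTop_add_const_right _ (-1) tendsto_id), 1, le_rfl,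
    (hpos 1 le_rfl).ne'⟩, hpos⟩
  exact ((hw _ (sub_nonneg.2 hs)).2.comp_sub_const s 1).hasDerivWithinAt.congr_deriv (by ring)

theorem IsDecayingSolution.neg {m : ℕ} {h x : ℝ → ℝ}
    (hx : IsDecayingSolution m (fun y => (-1) ^ m * h (-y)) x) :
    IsDecayingSolution m h fun s => -x s where
  hasDerivWithinAt s hs := (hx.hasDerivWithinAt s hs).neg.congr_deriv (by
    rw [neg_pow (x s)]
    ring)
  tendsto_zero := by simpa using hx.tendsto_zero.neg
  exists_ne_zero := by simpa using hx.exists_ne_zero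

theorem eventually_exists_isDecayingSolution {m : ℕ} {h : ℝ → ℝ} (hm : m ≠ 0)
    (hh : Continuous h) :
    ∀ᶠ x₀ in 𝓝 0, h 0 * x₀ ^ m < 0 →
      ∃ x, x 1 = x₀ ∧ IsDecayingSolution m h x ∧ ∀ s ≥ 1, 0 < x₀ * x s := by
  have right : ∀ᶠ x₀ in 𝓝[>] 0, h 0 < 0 →
      ∃ x, x 1 = x₀ ∧ IsDecayingSolution m h x ∧ ∀ s ≥ 1, 0 < x s :=
    eventually_imp_distrib_left.2 (eventually_exists_isDecayingSolution_of_neg hh · m)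
  have left : ∀ᶠ x₀ in 𝓝[<] 0, (-1) ^ m * h (-0) < 0 →
      ∃ x, x 1 = -x₀ ∧ IsDecayingSolution m (fun y => (-1) ^ m * h (-y)) x ∧ ∀ s ≥ 1, 0 < x s :=
    eventually_imp_distrib_left.2 fun hneg =>
      (neg_zero (G := ℝ) ▸ tendsto_neg_nhdsLT (a := (0 : ℝ))).eventually
        (eventually_exists_isDecayingSolution_of_neg (by fun_prop) hneg m)
  filter_upwards [eventually_nhdsWithin_iff.1 right, eventually_nhdsWithin_iff.1 left]
    with x₀ hright hleft hx₀
  rcases lt_trichotomy x₀ 0 with hneg | rfl | hpos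
  · obtain ⟨x, hx₁, hx, hxpos⟩ := hleft hneg (by
      rw [← neg_neg x₀, neg_pow, ← mul_assoc] at hx₀
      rw [neg_zero, mul_comm]
      exact neg_of_mul_neg_left hx₀ (pow_nonneg (neg_nonneg.2 hneg.le) m))
    exact ⟨fun s => -x s, neg_eq_iff_eq_neg.2 hx₁, hx.neg, fun s hs =>
      mul_pos_of_neg_of_neg hneg (neg_neg_of_pos (hxpos s hs))⟩
  · simp [hm] at hx₀
  · obtain ⟨x, hx₁, hx, hxpos⟩ := hright hpos (neg_of_mul_neg_left hx₀ (pow_nonneg hpos.le m))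
    exact ⟨x, hx₁, hx, fun s hs => mul_pos hpos (hxpos s hs)⟩

end Existence

section NormalForm

theorem exists_continuous_factor {ι : Type*} {s : Finset ι} {c : ι → ℝ} {e : ι → ℕ} {i₀ : ι}
    (hi₀ : i₀ ∈ s) (hlead : ∀ i ∈ s, i ≠ i₀ → c i = 0 ∨ e i₀ < e i) :
    ∃ f : ℝ → ℝ, Continuous f ∧ f 0 = c i₀ ∧
      ∀ x, ∑ i ∈ s, c i * x ^ e i = x ^ e i₀ * f x := by
  refine ⟨fun x => ∑ i ∈ s, c i * x ^ (e i - e i₀), by fun_prop, ?_, fun x => ?_⟩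
  · dsimp only
    rw [Finset.sum_eq_single_of_mem i₀ hi₀, Nat.sub_self, pow_zero, mul_one]
    intro i hi hne
    rcases hlead i hi hne with hc | he
    · rw [hc, zero_mul]
    · rw [zero_pow (Nat.sub_ne_zero_of_lt he), mul_zero]
  · rw [Finset.mul_sum]
    refine Finset.sum_congr rfl fun i hi => ?_
    rcases eq_or_ne i i₀ with rfl | hne
    · rw [Nat.sub_self, pow_zero, mul_one, mul_comm]
    rcases hlead i hi hne with hc | he
    · rw [hc, zero_mul, zero_mul, mul_zero]
    · rw [mul_left_comm, ← pow_add, Nat.add_sub_cancel' he.le]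

/-- The coefficients `a_0, …, a_(l-1), a_l = 1` of `r^(2l) + ∑_{i<l} a_i r^(2i)` as a polynomial
in `r ^ 2`, with the leading coefficient included so that the lowest nonzero one always exists. -/
def radialCoeff {l : ℕ} (a : Fin l → ℝ) : Fin (l + 1) → ℝ := Fin.snoc a 1

theorem exists_radial_factor (σ : ℝ) {l : ℕ} {a : Fin l → ℝ} {k : Fin (l + 1)}
    (ha : ∀ i < k, radialCoeff a i = 0) :
    ∃ f : ℝ → ℝ, Continuous f ∧ f 0 = σ * radialCoeff a k ∧
      ∀ x, σ * (x * (x ^ (2 * l) + ∑ i : Fin l, a i * x ^ (2 * (i : ℕ)))) =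
        x ^ (2 * (k : ℕ) + 1) * f x := by
  obtain ⟨f, hf, hf₀, hfactor⟩ := exists_continuous_factor (s := Finset.univ)
    (c := fun i => σ * radialCoeff a i) (e := fun i : Fin (l + 1) => 2 * (i : ℕ) + 1)
    (Finset.mem_univ k) (fun i _ hne => by
      rcases hne.lt_or_gt with hlt | hgt
      · exact Or.inl (by rw [ha i hlt, mul_zero])
      · exact Or.inr (by have := Fin.lt_def.1 hgt; omega))
  refine ⟨f, hf, hf₀, fun x => ?_⟩
  rw [← hfactor, Fin.sum_univ_castSucc]
  simp only [radialCoeff, Fin.snoc_castSucc, Fin.snoc_last, Fin.val_castSucc, Fin.val_last,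
    mul_add, Finset.mul_sum, pow_succ]
  rw [add_comm]
  congr 1
  · exact Finset.sum_congr rfl fun i _ => by ring
  · ring

theorem exists_vertical_factor {n p : ℕ} {b : ℕ → ℝ} (hp : 2 ≤ p) (hpn : p ≤ n)
    (hb : ∀ i, 2 ≤ i → i < p → b i = 0) :
    ∃ h : ℝ → ℝ, Continuous h ∧ h 0 = b p ∧
      ∀ x, ∑ i ∈ Finset.Icc 2 n, b i * x ^ i = x ^ (p - 1 + 1) * h x := by
  rw [Nat.sub_add_cancel (by omega)]
  refine exists_continuous_factor (e := id) (Finset.mem_Icc.2 ⟨hp, hpn⟩) fun i hi hne => ?_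
  exact hne.lt_or_gt.imp_left (hb i (Finset.mem_Icc.1 hi).1)

end NormalForm

section SpatialSpiral

theorem exists_affine_image_Ici {J : Set ℝ} {F : Filter ℝ}
    (hJF : (∃ t₀, J = Ici t₀ ∧ F = atTop) ∨ ∃ t₀, J = Iic t₀ ∧ F = atBot) :
    ∃ τ c : ℝ, (τ = 1 ∨ τ = -1) ∧ (fun s => τ * s + c) '' Ici 1 = J ∧
      Tendsto (fun s => τ * s + c) atTop F := by
  rcases hJF with ⟨t₀, rfl, rfl⟩ | ⟨t₀, rfl, rfl⟩
  · refine ⟨1, t₀ - 1, Or.inl rfl, by simp, ?_⟩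
    simpa only [one_mul, id_eq] using tendsto_atTop_add_const_right _ (t₀ - 1) tendsto_id
  · refine ⟨-1, t₀ + 1, Or.inr rfl, by simp [← sub_eq_neg_add], ?_⟩
    simpa only [neg_one_mul] using tendsto_atBot_add_const_right _ _ tendsto_neg_atTop_atBot

theorem exists_halfLine_mul_image {τ : ℝ} (hτ : τ = 1 ∨ τ = -1) :
    ∃ (J : Set ℝ) (F : Filter ℝ),
      ((∃ t₀, J = Ici t₀ ∧ F = atTop) ∨ ∃ t₀, J = Iic t₀ ∧ F = atBot) ∧
      (fun t => τ * t) '' J = Ici 1 ∧ Tendsto (fun t => τ * t) F atTop := by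
  rcases hτ with rfl | rfl
  · refine ⟨Ici 1, atTop, Or.inl ⟨1, rfl, rfl⟩, by simp, ?_⟩
    exact tendsto_id.congr fun t => (one_mul t).symm
  · exact ⟨Iic (-1), atBot, Or.inr ⟨-1, rfl, rfl⟩, by simp,
      by simpa using tendsto_neg_atBot_atTop⟩

theorem abs_sub_eq_of_hasDerivWithinAt_const {D : Set ℝ} (hD : Convex ℝ D) {φ : ℝ → ℝ} {c : ℝ}
    (hφ : ∀ s ∈ D, HasDerivWithinAt φ c D s) {s t : ℝ} (hs : s ∈ D) (ht : t ∈ D) :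
    |φ s - φ t| = |c| * |s - t| := by
  have deriv : ∀ x ∈ D, HasDerivWithinAt (fun x => φ x - c * x) 0 D x := fun x hx => by
    have linear := ((hasDerivAt_id x).const_mul c).hasDerivWithinAt (s := D)
    exact ((hφ x hx).sub linear).congr_deriv (by ring)
  have constant := hD.norm_image_sub_le_of_norm_hasDerivWithin_le (C := 0) deriv
    (fun x _ => norm_zero.le) ht hs
  rw [zero_mul, norm_le_zero_iff] at constant
  rw [← abs_mul]
  congr 1
  linarith

variable {σ : ℝ} {l n j m : ℕ} {a : Fin l → ℝ} {b : ℕ → ℝ} {f h : ℝ → ℝ}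
  {Γ : Set (EuclideanSpace ℝ (Fin 3))}

variable (hf : ∀ x, σ * (x * (x ^ (2 * l) + ∑ i : Fin l, a i * x ^ (2 * (i : ℕ)))) =
    x ^ (j + 1) * f x) (hh : ∀ x, ∑ i ∈ Finset.Icc 2 n, b i * x ^ i = x ^ (m + 1) * h x)
include hf hh

theorem IsSpatialSpiral.exists_isDecayingSolution (hΓ : IsSpatialSpiral σ l a n b Γ) :
    ∃ τ : ℝ, (τ = 1 ∨ τ = -1) ∧ ∃ r φ z : ℝ → ℝ,
      IsDecayingSolution j (fun x => τ * f x) r ∧ (∀ s ≥ 1, 0 < r s) ∧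
      (∀ s ≥ 1, HasDerivWithinAt φ τ (Ici 1) s) ∧ IsDecayingSolution m (fun x => τ * h x) z ∧
      Γ = (fun s => cylPoint (r s) (φ s) (z s)) '' Ici 1 := by
  obtain ⟨J, F, r, φ, z, hJF, hsol, hlim, hz, rfl⟩ := hΓ
  obtain ⟨τ, c, hτ, rfl, hF⟩ := exists_affine_image_Ici hJF
  have maps := mapsTo_image (fun s => τ * s + c) (Ici 1)
  have hζ : ∀ s, HasDerivWithinAt (fun s => τ * s + c) τ (Ici 1) s := fun s => by
    simpa using (((hasDerivAt_id s).const_mul τ).add_const c).hasDerivWithinAt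
  obtain ⟨hr_lim, hz_lim⟩ := tendsto_cylPoint_zero_iff.1 hlim
  have r_pos : ∀ s ≥ 1, 0 < r (τ * s + c) := fun s hs => hsol.r_pos _ (maps hs)
  refine ⟨τ, hτ, fun s => r (τ * s + c), fun s => φ (τ * s + c), fun s => z (τ * s + c),
    ⟨fun s hs => ?_, hr_lim.comp hF, 1, le_rfl, (r_pos 1 le_rfl).ne'⟩, r_pos,
    fun s hs => ?_, ⟨fun s hs => ?_, hz_lim.comp hF, by simpa using hz⟩,
    image_image _ _ _⟩
  · have hr := hsol.deriv_r _ (maps hs)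
    rw [hf] at hr
    exact (hr.comp s (hζ s) maps).congr_deriv (by ring)
  · exact ((hsol.deriv_φ _ (maps hs)).comp s (hζ s) maps).congr_deriv (one_mul τ)
  · have hz := hsol.deriv_z _ (maps hs)
    rw [hh] at hz
    exact (hz.comp s (hζ s) maps).congr_deriv (by ring)

theorem isSpatialSpiral_image_of_isDecayingSolution {τ : ℝ} (hτ : τ = 1 ∨ τ = -1)
    {r φ z : ℝ → ℝ} (hr : IsDecayingSolution j (fun x => τ * f x) r) (r_pos : ∀ s ≥ 1, 0 < r s)
    (hφ : ∀ s ≥ 1, HasDerivWithinAt φ τ (Ici 1) s)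
    (hz : IsDecayingSolution m (fun x => τ * h x) z) :
    IsSpatialSpiral σ l a n b ((fun s => cylPoint (r s) (φ s) (z s)) '' Ici 1) := by
  obtain ⟨J, F, hJF, hJ, hF⟩ := exists_halfLine_mul_image hτ
  have hττ : τ * τ = 1 := mul_self_eq_one_iff.2 hτ
  have maps : MapsTo (fun t => τ * t) J (Ici 1) := mapsTo_iff_image_subset.2 hJ.subset
  have hζ : ∀ t, HasDerivWithinAt (fun t => τ * t) τ J t := fun t => by
    simpa using ((hasDerivAt_id t).const_mul τ).hasDerivWithinAt
  refine ⟨J, F, fun t => r (τ * t), fun t => φ (τ * t), fun t => z (τ * t), hJF,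
    ⟨fun t ht => r_pos _ (maps ht), fun t ht => ?_, fun t ht => ?_, fun t ht => ?_⟩,
    tendsto_cylPoint_zero_iff.2 ⟨hr.tendsto_zero.comp hF, hz.tendsto_zero.comp hF⟩, ?_, ?_⟩
  · rw [hf]
    refine ((hr.hasDerivWithinAt _ (maps ht)).comp t (hζ t) maps).congr_deriv ?_
    linear_combination r (τ * t) ^ (j + 1) * f (r (τ * t)) * hττ
  · exact ((hφ _ (maps ht)).comp t (hζ t) maps).congr_deriv hττ
  · rw [hh]
    refine ((hz.hasDerivWithinAt _ (maps ht)).comp t (hζ t) maps).congr_deriv ?_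
    linear_combination z (τ * t) ^ (m + 1) * h (z (τ * t)) * hττ
  · obtain ⟨s, hs, hzs⟩ := hz.exists_ne_zero
    obtain ⟨t, ht, rfl⟩ := hJ.symm ▸ mem_Ici.2 hs
    exact ⟨t, ht, hzs⟩
  · rw [← hJ, image_image]

theorem exists_isSpatialSpiral (hj : j ≠ 0) (hm : m ≠ 0) (hfc : Continuous f) (hf₀ : f 0 ≠ 0)
    (hhc : Continuous h) :
    ∃ δ > 0, ∀ r₀ φ₀ z₀ : ℝ, 0 < r₀ → r₀ < δ → |z₀| < δ → 0 < f 0 * h 0 * z₀ ^ m →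
      ∃ Γ, cylPoint r₀ φ₀ z₀ ∈ Γ ∧ IsSpatialSpiral σ l a n b Γ := by
  obtain ⟨τ, hτ, hτf⟩ : ∃ τ : ℝ, (τ = 1 ∨ τ = -1) ∧ τ * f 0 < 0 := by
    rcases hf₀.lt_or_gt with hneg | hpos
    · exact ⟨1, Or.inl rfl, by linarith⟩
    · exact ⟨-1, Or.inr rfl, by linarith⟩
  obtain ⟨δ, hδ, hnear⟩ := Metric.eventually_nhds_iff.1
    ((eventually_exists_isDecayingSolution hj (h := fun x => τ * f x) (by fun_prop)).and
      (eventually_exists_isDecayingSolution hm (h := fun x => τ * h x) (by fun_prop)))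
  refine ⟨δ, hδ, fun r₀ φ₀ z₀ hr₀ hr₀δ hz₀δ hsign => ?_⟩
  have hτh : τ * h 0 * z₀ ^ m < 0 := by
    refine neg_of_mul_pos_right (a := τ * f 0) (hsign.trans_eq ?_) hτf.le
    linear_combination -(f 0 * h 0 * z₀ ^ m) * mul_self_eq_one_iff.2 hτ
  obtain ⟨r, hr₁, hr, hr_sign⟩ := (hnear (by rwa [Real.dist_0_eq_abs, abs_of_pos hr₀])).1
    (mul_neg_of_neg_of_pos hτf (pow_pos hr₀ j))
  obtain ⟨z, hz₁, hz, -⟩ := (hnear (by rwa [Real.dist_0_eq_abs])).2 hτh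
  have hφ : ∀ s ≥ 1, HasDerivWithinAt (fun s => φ₀ + τ * (s - 1)) τ (Ici 1) s := fun s _ => by
    simpa using ((((hasDerivAt_id s).sub_const 1).const_mul τ).const_add φ₀).hasDerivWithinAt
  have r_pos : ∀ s ≥ 1, 0 < r s := fun s hs => pos_of_mul_pos_right (hr_sign s hs) hr₀.le
  refine ⟨(fun s => cylPoint (r s) (φ₀ + τ * (s - 1)) (z s)) '' Ici 1, ⟨1, self_mem_Ici, ?_⟩,
    isSpatialSpiral_image_of_isDecayingSolution hf hh hτ hr r_pos hφ hz⟩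
  simp only [hr₁, hz₁, sub_self, mul_zero, add_zero]

theorem IsSpatialSpiral.hasBoxDim_of_factor (hj : 2 ≤ j) (hm : m ≠ 0) (hfc : Continuous f)
    (hf₀ : f 0 ≠ 0) (hhc : Continuous h) (hh₀ : h 0 ≠ 0) (hΓ : IsSpatialSpiral σ l a n b Γ) :
    HasBoxDim Γ (1 + (1 - (j : ℝ)⁻¹) / (1 + min (j : ℝ)⁻¹ (m : ℝ)⁻¹)) := by
  obtain ⟨τ, hτ, r, φ, z, hr, r_pos, hφ, hz, rfl⟩ := hΓ.exists_isDecayingSolution hf hh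
  have hτ₀ : τ ≠ 0 := by rcases hτ with rfl | rfl <;> norm_num
  have hτ_abs : |τ| = 1 := by rcases hτ with rfl | rfl <;> simp
  have angle : ∀ s ≥ 1, ∀ t ≥ 1, |φ s - φ t| = |s - t| := fun s hs t ht => by
    rw [abs_sub_eq_of_hasDerivWithinAt_const (convex_Ici 1) hφ hs ht, hτ_abs, one_mul]
  have hj₁ : (1 : ℝ) < j := by exact_mod_cast hj
  exact (isPowerSpiral_of_isDecayingSolution (by omega) hm (f := fun x => τ * f x)
    (h := fun x => τ * h x) (by fun_prop) (mul_ne_zero hτ₀ hf₀) (by fun_prop)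
    (mul_ne_zero hτ₀ hh₀) hr (fun s hs => (r_pos s hs).le) hz angle).hasBoxDim
    (by positivity) (inv_lt_one_of_one_lt₀ hj₁) (by positivity)

end SpatialSpiral

theorem theorem4_general {σ : ℝ} (hσ : σ ≠ 0) {l : ℕ} {a : Fin l → ℝ} {k : Fin (l + 1)}
    (hk : k ≠ 0) (ha : ∀ i < k, radialCoeff a i = 0) (hak : radialCoeff a k ≠ 0) {n p : ℕ}
    (hp : 2 ≤ p) (hpn : p ≤ n) {b : ℕ → ℝ} (hb : ∀ i, 2 ≤ i → i < p → b i = 0)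
    (hbp : b p ≠ 0) :
    (∃ δ > 0, ∀ r₀ φ₀ z₀ : ℝ, 0 < r₀ → r₀ < δ → |z₀| < δ →
      0 < σ * radialCoeff a k * b p * z₀ ^ (p - 1) →
      ∃ Γ, cylPoint r₀ φ₀ z₀ ∈ Γ ∧ IsSpatialSpiral σ l a n b Γ) ∧
    ∀ Γ, IsSpatialSpiral σ l a n b Γ → HasBoxDim Γ
      (1 + (1 - (2 * (k : ℝ))⁻¹) / (1 + min (2 * (k : ℝ))⁻¹ ((p : ℝ) - 1)⁻¹)) := by
  obtain ⟨f, hfc, hf₀, hf⟩ := exists_radial_factor σ ha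
  obtain ⟨h, hhc, hh₀, hh⟩ := exists_vertical_factor hp hpn hb
  have hk₀ : 0 < (k : ℕ) := Fin.pos_iff_ne_zero.2 hk
  have hf₀_ne : f 0 ≠ 0 := hf₀ ▸ mul_ne_zero hσ hak
  rw [← hf₀, ← hh₀]
  refine ⟨exists_isSpatialSpiral hf hh (by omega) (by omega) hfc hf₀_ne hhc, fun Γ hΓ => ?_⟩
  have dim := hΓ.hasBoxDim_of_factor hf hh (by omega) (by omega) hfc hf₀_ne hhc (hh₀ ▸ hbp)
  simpa only [Nat.cast_mul, Nat.cast_ofNat, Nat.cast_sub (one_le_two.trans hp), Nat.cast_one]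
    using dim

theorem cubic_dimension_eq_of_le_three {p : ℝ} (hp : 1 < p) (hp₃ : p ≤ 3) :
    1 + (1 - 2⁻¹) / (1 + min 2⁻¹ (p - 1)⁻¹) = 4 / 3 := by
  rw [min_eq_left (inv_anti₀ (by linarith) (by linarith))]
  norm_num

theorem cubic_dimension_eq_of_three_le {p : ℝ} (hp : 3 ≤ p) :
    1 + (1 - 2⁻¹) / (1 + min 2⁻¹ (p - 1)⁻¹) = 3 / 2 - 1 / (2 * p) := by
  rw [min_eq_right (inv_anti₀ two_pos (by linarith))]
  have hp₁ : p - 1 ≠ 0 := by linarith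
  have hp₀ : p ≠ 0 := by linarith
  have denom : 1 + (p - 1)⁻¹ = p / (p - 1) := by
    field_simp
    ring
  rw [denom]
  field_simp
  ring

theorem theorem4 (σ : ℝ) (hσ : σ = 1 ∨ σ = -1) (a : Fin 1 → ℝ) (ha : a 0 = 0)
    (n p : ℕ) (hp : 2 ≤ p) (hpn : p ≤ n) (b : ℕ → ℝ)
    (hb : ∀ i, 2 ≤ i → i < p → b i = 0) (hbp : b p < 0) :
    (∃ δ : ℝ, 0 < δ ∧ ∀ r₀ φ₀ z₀ : ℝ, 0 < r₀ → r₀ < δ → |z₀| < δ → 0 < σ * b p * z₀ ^ (p - 1) →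
      ∃ Γ, cylPoint r₀ φ₀ z₀ ∈ Γ ∧ IsSpatialSpiral σ 1 a n b Γ) ∧
    (∀ Γ, IsSpatialSpiral σ 1 a n b Γ →
      (p ≤ 3 → HasBoxDim Γ (4 / 3)) ∧
      (4 ≤ p → HasBoxDim Γ (3 / 2 - 1 / (2 * (p : ℝ))))) := by
  have hσ₀ : σ ≠ 0 := by rcases hσ with rfl | rfl <;> norm_num
  have ha₀ : ∀ i < Fin.last 1, radialCoeff a i = 0 := by
    simpa [Fin.forall_fin_two, radialCoeff, Fin.snoc] using ha
  have ha₁ : radialCoeff a (Fin.last 1) = 1 := Fin.snoc_last _ _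
  obtain ⟨exist, dim⟩ := theorem4_general hσ₀ (Fin.last_pos.ne') ha₀ (ha₁ ▸ one_ne_zero) hp hpn
    hb hbp.ne
  simp only [ha₁, mul_one, Fin.val_last, zero_add, Nat.cast_one] at exist dim
  refine ⟨exist, fun Γ hΓ => ⟨fun hp₃ => ?_, fun hp₄ => ?_⟩⟩
  · rw [← cubic_dimension_eq_of_le_three (p := p) (by exact_mod_cast hp) (by exact_mod_cast hp₃)]
    exact dim Γ hΓ
  · rw [← cubic_dimension_eq_of_three_le (by exact_mod_cast (by omega : 3 ≤ p))]
    exact dim Γ hΓ
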